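/- Fix $\vec\theta=(\theta_0,\theta_t,\theta_1,\theta_\infty)\in\mathbb C^4$. For $\mu\in\{0,t,1,\infty\}$ put $p_\mu=2\cos2\pi\theta_\mu$, and for $\sigma_{0t},\sigma_{1t}\in\mathbb C$ put $p_{0t}=2\cos 2\pi\sigma_{0t}$, $p_{1t}=2\cos2\pi\sigma_{1t}$. Let $$W=p_{0t}p_{1t}p_{01}+p_{0t}^2+p_{1t}^2+p_{01}^2-\omega_{0t}p_{0t}-\omega_{1t}p_{1t}-\omega_{01}p_{01}+\omega_4-4,$$ where $\omega_{0t}=p_0p_t+p_1p_\infty$, $\omega_{1t}=p_tp_1+p_0p_\infty$, $\omega_{01}=p_0p_1+p_tp_\infty$, $\omega_4=p_0p_tp_1p_\infty+p_0^2+p_t^2+p_1^2+p_\infty^2$, and let $q_{\mu\nu}=\partial W/\partial p_{\mu\nu}$. Let $\mathcal M_{\vec\theta}$ be the set of triples $(\sigma_{0t},\sigma_{1t};p_{01})\in\mathbb C^3$ with $W(p_{0t},p_{1t},p_{01})=0$. Define $$s_{0t}^{\pm1}=\frac{q_{01}e^{\pm2\pi i\sigma_{0t}}-q_{1t}}{16\prod_{\epsilon=\pm}\sin\pi(\theta_t\mp\sigma_{0t}+\epsilon\theta_0)\sin\pi(\theta_1\mp\sigma_{0t}+\epsilon\theta_\infty)},\qquad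 s_{1t}^{\pm1}=\frac{q_{01}e^{\mp2\pi i\sigma_{1t}}-q_{0t}}{16\prod_{\epsilon=\pm}\sin\pi(\theta_t\mp\sigma_{1t}+\epsilon\theta_1)\sin\pi(\theta_0\mp\sigma_{1t}+\epsilon\theta_\infty)}.$$ Let $\nu_1=\sigma_{0t}+\theta_0+\theta_t$, $\nu_2=\sigma_{0t}+\theta_1+\theta_\infty$, $\nu_3=\sigma_{1t}+\theta_0+\theta_\infty$, $\nu_4=\sigma_{1t}+\theta_t+\theta_1$, $2\nu_\Sigma=\nu_1+\nu_2+\nu_3+\nu_4$, and $\lambda_1=\theta_0+\theta_t+\theta_1+\theta_\infty$, $\lambda_2=\sigma_{0t}+\sigma_{1t}+\theta_0+\theta_1$, $\lambda_3=\sigma_{0t}+\sigma_{1t}+\theta_t+\theta_\infty$, $\lambda_4=0$, and $$z_+=\frac{4\sin2\pi\sigma_{0t}\sin2\pi\sigma_{1t}+4\sin2\pi\theta_t\sin2\pi\theta_\infty+4\sin2\pi\theta_0\sin2\pi\theta_1+q_{01}}{2\sum_{k=1}^4\left(e^{2\pi i(\nu_\Sigma-\nu_k)}-e^{2\pi i(\nu_\Sigma-\lambda_k)}\right)}.$$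 Let $G$ be the Barnes $G$-function, $\hat G(x)=G(1+x)/G(1-x)$, $$C\Bigl[\begin{smallmatrix}\theta_1&\theta_t\\ \theta_\infty&\theta_0\end{smallmatrix};\sigma\Bigr]=\frac{\prod_{\epsilon,\epsilon'=\pm}G(1+\theta_t+\epsilon\theta_0+\epsilon'\sigma)\,G(1+\theta_1+\epsilon\theta_\infty+\epsilon'\sigma)}{\prod_{\epsilon=\pm}G(1+2\epsilon\sigma)},$$ and, for a function $\chi_{01}$ of $(\sigma_{0t},\sigma_{1t};p_{01})$, let $\bar\chi_{01}=\chi_{01}\,C\bigl[\begin{smallmatrix}\theta_0&\theta_t\\ \theta_\infty&\theta_1\end{smallmatrix};\sigma_{1t}\bigr]\big/C\bigl[\begin{smallmatrix}\theta_1&\theta_t\\ \theta_\infty&\theta_0\end{smallmatrix};\sigma_{0t}\bigr]$. Call a point of $\mathcal M_{\vec\theta}$ generic if, for all signs $\epsilon,\epsilon'$, none of $\theta_t+\epsilon\theta_0+\epsilon'\sigma_{0t}$, $\theta_1+\epsilon\theta_\infty+\epsilon'\sigma_{0t}$, $\theta_t+\epsilon\theta_1+\epsilon'\sigma_{1t}$,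 $\theta_0+\epsilon\theta_\infty+\epsilon'\sigma_{1t}$, $2\sigma_{0t}$, $2\sigma_{1t}$ is an integer, and the numerator and the denominator of $z_+$ are both nonzero. Let $D$ be any set of generic points of $\mathcal M_{\vec\theta}$ invariant under the two unit shifts $\sigma_{0t}\mapsto\sigma_{0t}+1$ and $\sigma_{1t}\mapsto\sigma_{1t}+1$ at fixed $p_{01}$ (for instance all generic points, or the graph of a periodic branch of $p_{01}$), and for each point of $D$ choose arbitrarily $\omega_+$ with $e^{2\pi i\omega_+}=z_+$. Then on $D$ the two formulas (upper and lower sign) for $s_{0t}^{\pm1}$, and likewise those for $s_{1t}^{\pm1}$, are mutually inverse, and $z=z_+$ solves $\prod_{k=1}^4(1-ze^{2\pi i\nu_k})=\prod_{k=1}^4(1-ze^{2\pi i\lambda_k})$. Moreover a function $\chi_{01}$ satisfies on $D$ the difference equations $$\chi_{01}(\sigma_{0t}+1,\sigma_{1t};p_{01})=s_{0t}^{-1}\,\chi_{01}(\sigma_{0t},\sigma_{1t};p_{01}),\qquad \chi_{01}(\sigma_{0t},\sigma_{1t}+1;p_{01})=s_{1t}\,\chi_{01}(\sigma_{0t},\sigma_{1t};p_{01})$$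 if and only if on $D$ $$\bar\chi_{01}=\chi_{\mathrm{per}}\prod_{\epsilon,\epsilon'=\pm}\frac{G(1+\epsilon\sigma_{1t}+\epsilon'\theta_t-\epsilon\epsilon'\theta_1)\,G(1+\epsilon\sigma_{1t}+\epsilon'\theta_0-\epsilon\epsilon'\theta_\infty)}{G(1+\epsilon\sigma_{0t}+\epsilon'\theta_t+\epsilon\epsilon'\theta_0)\,G(1+\epsilon\sigma_{0t}+\epsilon'\theta_1+\epsilon\epsilon'\theta_\infty)}\prod_{\epsilon=\pm}\frac{G(1+2\epsilon\sigma_{0t})}{G(1+2\epsilon\sigma_{1t})}\prod_{k=1}^4\frac{\hat G(\omega_++\nu_k)}{\hat G(\omega_++\lambda_k)}$$ for some function $\chi_{\mathrm{per}}$ of $(\sigma_{0t},\sigma_{1t};p_{01})$ that is periodic with period $1$ in $\sigma_{0t}$ and in $\sigma_{1t}$. If each $(\sigma_{0t},\sigma_{1t})$ occurs in at most one point of $D$ (a single-valued branch of $p_{01}$), then the same holds with $\chi_{\mathrm{per}}$ a function of $(\sigma_{0t},\sigma_{1t})$ only. -/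

import Mathlib

open scoped BigOperators

noncomputable section

/-- The Barnes `G`-function, through its Weierstrass product
`G(1+z) = (2π)^{z/2} exp(-(z + z²(1+γ))/2) ∏_{k≥1} (1+z/k)^k exp(z²/(2k) - z)`. -/
def barnesG (x : ℂ) : ℂ :=
  Complex.exp ((x - 1) / 2 * (Real.log (2 * Real.pi) : ℂ)
      - ((x - 1) + (x - 1) ^ 2 * (1 + (Real.eulerMascheroniConstant : ℂ))) / 2) *
    ∏' k : ℕ, ((1 + (x - 1) / ((k : ℂ) + 1)) ^ (k + 1) *
      Complex.exp ((x - 1) ^ 2 / (2 * ((k : ℂ) + 1)) - (x - 1)))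

/-- `Ĝ(x) = G(1+x)/G(1-x)`. -/
def barnesGHat (x : ℂ) : ℂ := barnesG (1 + x) / barnesG (1 - x)

namespace PVI

/-- The two signs `±`, over which `ε` and `ε'` run. -/
def signs : Finset ℂ := {1, -1}

/-- `sin (π x)`. -/
def sinpi (x : ℂ) : ℂ := Complex.sin ((Real.pi : ℂ) * x)

/-- `e^{2π i x}`. -/
def e2pi (x : ℂ) : ℂ := Complex.exp (2 * (Real.pi : ℂ) * Complex.I * x)

/-- `2 cos (2π x)`. -/
def tr (x : ℂ) : ℂ := 2 * Complex.cos (2 * (Real.pi : ℂ) * x)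

/-- The Painlevé VI parameters `(θ₀, θₜ, θ₁, θ_∞)`. -/
@[ext] structure Params where
  th0 : ℂ
  tht : ℂ
  th1 : ℂ
  thinf : ℂ

/-- Triples `(σ₀ₜ, σ₁ₜ; p₀₁)`. -/
@[ext] structure Point where
  s0 : ℂ
  s1 : ℂ
  p01 : ℂ

/-- `(σ₀ₜ, σ₁ₜ; p₀₁) ↦ (σ₀ₜ + 1, σ₁ₜ; p₀₁)`. -/
def shift0 (P : Point) : Point := ⟨P.s0 + 1, P.s1, P.p01⟩

/-- `(σ₀ₜ, σ₁ₜ; p₀₁) ↦ (σ₀ₜ, σ₁ₜ + 1; p₀₁)`. -/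
def shift1 (P : Point) : Point := ⟨P.s0, P.s1 + 1, P.p01⟩

/-- `ω₀ₜ = p₀ pₜ + p₁ p_∞`. -/
def omega0t (θ : Params) : ℂ := tr θ.th0 * tr θ.tht + tr θ.th1 * tr θ.thinf

/-- `ω₁ₜ = pₜ p₁ + p₀ p_∞`. -/
def omega1t (θ : Params) : ℂ := tr θ.tht * tr θ.th1 + tr θ.th0 * tr θ.thinf

/-- `ω₀₁ = p₀ p₁ + pₜ p_∞`. -/
def omega01 (θ : Params) : ℂ := tr θ.th0 * tr θ.th1 + tr θ.tht * tr θ.thinf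

/-- `ω₄ = p₀ pₜ p₁ p_∞ + p₀² + pₜ² + p₁² + p_∞²`. -/
def omega4 (θ : Params) : ℂ :=
  tr θ.th0 * tr θ.tht * tr θ.th1 * tr θ.thinf
    + (tr θ.th0 ^ 2 + tr θ.tht ^ 2 + tr θ.th1 ^ 2 + tr θ.thinf ^ 2)

/-- The Jimbo–Fricke cubic polynomial `W(p₀ₜ, p₁ₜ, p₀₁)`. -/
def cubicW (θ : Params) (p0t p1t p01 : ℂ) : ℂ :=
  p0t * p1t * p01 + p0t ^ 2 + p1t ^ 2 + p01 ^ 2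
    - omega0t θ * p0t - omega1t θ * p1t - omega01 θ * p01 + omega4 θ - 4

/-- The double cover of the `(σ₀ₜ, σ₁ₜ)`-plane cut out by the Jimbo–Fricke relation. -/
def monodromySpace (θ : Params) : Set Point :=
  {P | cubicW θ (tr P.s0) (tr P.s1) P.p01 = 0}

/-- `q₀ₜ = ∂W/∂p₀ₜ`. -/
def q0t (θ : Params) (P : Point) : ℂ := 2 * tr P.s0 + tr P.s1 * P.p01 - omega0t θ

/-- `q₁ₜ = ∂W/∂p₁ₜ`. -/
def q1t (θ : Params) (P : Point) : ℂ := 2 * tr P.s1 + tr P.s0 * P.p01 - omega1t θ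

/-- `q₀₁ = ∂W/∂p₀₁`. -/
def q01 (θ : Params) (P : Point) : ℂ := 2 * P.p01 + tr P.s0 * tr P.s1 - omega01 θ

/-- The right side of Jimbo's formula for `s₀ₜ^{δ}`, where `δ = ±1`. -/
def jimbo0 (θ : Params) (δ : ℂ) (P : Point) : ℂ :=
  (q01 θ P * e2pi (δ * P.s0) - q1t θ P) /
    (16 * ∏ ε ∈ signs, sinpi (θ.tht - δ * P.s0 + ε * θ.th0) *
      sinpi (θ.th1 - δ * P.s0 + ε * θ.thinf))

/-- The right side of Jimbo's formula for `s₁ₜ^{δ}`, where `δ = ±1`. -/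
def jimbo1 (θ : Params) (δ : ℂ) (P : Point) : ℂ :=
  (q01 θ P * e2pi (-δ * P.s1) - q0t θ P) /
    (16 * ∏ ε ∈ signs, sinpi (θ.tht - δ * P.s1 + ε * θ.th1) *
      sinpi (θ.th0 - δ * P.s1 + ε * θ.thinf))

/-- The monodromy parameter `s₀ₜ`. -/
def s0t (θ : Params) (P : Point) : ℂ := jimbo0 θ 1 P

/-- The monodromy parameter `s₁ₜ`. -/
def s1t (θ : Params) (P : Point) : ℂ := jimbo1 θ 1 P

/-- The parameters `ν₁, …, ν₄`. -/
def nu (θ : Params) (P : Point) : Fin 4 → ℂ :=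
  ![P.s0 + θ.th0 + θ.tht, P.s0 + θ.th1 + θ.thinf,
    P.s1 + θ.th0 + θ.thinf, P.s1 + θ.tht + θ.th1]

/-- The parameters `λ₁, …, λ₄`. -/
def lam (θ : Params) (P : Point) : Fin 4 → ℂ :=
  ![θ.th0 + θ.tht + θ.th1 + θ.thinf, P.s0 + P.s1 + θ.th0 + θ.th1,
    P.s0 + P.s1 + θ.tht + θ.thinf, 0]

/-- `ν_Σ`, with `2 ν_Σ = ν₁ + ν₂ + ν₃ + ν₄`. -/
def nuSigma (θ : Params) (P : Point) : ℂ := (∑ k, nu θ P k) / 2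

/-- The denominator of the expression for `z₊`. -/
def zDen (θ : Params) (P : Point) : ℂ :=
  2 * ∑ k, (e2pi (nuSigma θ P - nu θ P k) - e2pi (nuSigma θ P - lam θ P k))

/-- The numerator of the expression for `z₊`. -/
def zNum (θ : Params) (P : Point) : ℂ :=
  4 * sinpi (2 * P.s0) * sinpi (2 * P.s1) + 4 * sinpi (2 * θ.tht) * sinpi (2 * θ.thinf)
    + 4 * sinpi (2 * θ.th0) * sinpi (2 * θ.th1) + q01 θ P

/-- `z₊ = e^{2π i ω₊}`. -/
def zPlus (θ : Params) (P : Point) : ℂ := zNum θ P / zDen θ P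

/-- The equation `∏ (1 - z e^{2π i ν_k}) = ∏ (1 - z e^{2π i λ_k})`. -/
def TetraEq (θ : Params) (P : Point) (z : ℂ) : Prop :=
  ∏ k, (1 - z * e2pi (nu θ P k)) = ∏ k, (1 - z * e2pi (lam θ P k))

/-- The structure constant `C[θ₁ θₜ; θ_∞ θ₀; σ]`, with arguments in the order
`θ₁, θₜ, θ_∞, θ₀, σ`. -/
def structC (a t b c σ : ℂ) : ℂ :=
  (∏ ε ∈ signs, ∏ ε' ∈ signs,
      barnesG (1 + t + ε * c + ε' * σ) * barnesG (1 + a + ε * b + ε' * σ)) /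
    ∏ ε ∈ signs, barnesG (1 + 2 * ε * σ)

/-- `χ̄₀₁ = χ₀₁ · C[θ₀ θₜ; θ_∞ θ₁; σ₁ₜ] / C[θ₁ θₜ; θ_∞ θ₀; σ₀ₜ]`. -/
def chiBar (θ : Params) (χ : Point → ℂ) (P : Point) : ℂ :=
  χ P * structC θ.th0 θ.tht θ.thinf θ.th1 P.s1 / structC θ.th1 θ.tht θ.thinf θ.th0 P.s0

/-- Points at which the sines and Barnes functions below, apart from those involving `ω₊`,
are neither zero nor infinite, and at which `z₊` is a well-defined nonzero number. -/
structure IsGeneric (θ : Params) (P : Point) : Prop where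
  sin_0t : ∀ ε ∈ signs, ∀ ε' ∈ signs, sinpi (θ.tht + ε * θ.th0 + ε' * P.s0) ≠ 0
  sin_1inf : ∀ ε ∈ signs, ∀ ε' ∈ signs, sinpi (θ.th1 + ε * θ.thinf + ε' * P.s0) ≠ 0
  sin_t1 : ∀ ε ∈ signs, ∀ ε' ∈ signs, sinpi (θ.tht + ε * θ.th1 + ε' * P.s1) ≠ 0
  sin_0inf : ∀ ε ∈ signs, ∀ ε' ∈ signs, sinpi (θ.th0 + ε * θ.thinf + ε' * P.s1) ≠ 0
  sin_s0 : sinpi (2 * P.s0) ≠ 0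
  sin_s1 : sinpi (2 * P.s1) ≠ 0
  den : zDen θ P ≠ 0
  num : zNum θ P ≠ 0

/-- `χ` solves, on `D`, the two difference equations `χ(σ₀ₜ + 1) / χ = s₀ₜ⁻¹` and
`χ(σ₁ₜ + 1) / χ = s₁ₜ`. They are cleared of the denominator `χ`, so that zeros of `χ`
are allowed. -/
def IsSolution (θ : Params) (D : Set Point) (χ : Point → ℂ) : Prop :=
  ∀ P ∈ D, χ (shift0 P) = (s0t θ P)⁻¹ * χ P ∧ χ (shift1 P) = s1t θ P * χ P

/-- The explicit product of Barnes functions, as a function of the point and of `w = ω₊`. -/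
def explicitProduct (θ : Params) (P : Point) (w : ℂ) : ℂ :=
  (∏ ε ∈ signs, ∏ ε' ∈ signs,
      (barnesG (1 + ε * P.s1 + ε' * θ.tht - ε * ε' * θ.th1) *
          barnesG (1 + ε * P.s1 + ε' * θ.th0 - ε * ε' * θ.thinf)) /
        (barnesG (1 + ε * P.s0 + ε' * θ.tht + ε * ε' * θ.th0) *
          barnesG (1 + ε * P.s0 + ε' * θ.th1 + ε * ε' * θ.thinf))) *
    (∏ ε ∈ signs, barnesG (1 + 2 * ε * P.s0) / barnesG (1 + 2 * ε * P.s1)) *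
    ∏ k, barnesGHat (w + nu θ P k) / barnesGHat (w + lam θ P k)

end PVI

end

/-! A solution divided by a nowhere vanishing solution is periodic on `D`, so everything rests on
one such particular solution. Once the structure constants are removed
(`explicitProduct_mul_structC_div`), the explicit product is a quotient of values of Ĝ only:
`baseFactor`, free of ω₊, times `tetraFactor`. By Ĝ(x+1) = -(π / sin πx) Ĝ(x) (`barnesGHat_add_one`,
from Stirling's formula and Euler's sine product), a unit shift multiplies it by a quotient of
sines, which has to be identified with s₀ₜ⁻¹ or s₁ₜ.

These identities are algebraic in the exponentials. The two sides of the quartic equation for z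
agree in degrees 0 and 4, so their difference is a nonzero constant times z(Az² - Bz + C). The
discriminant of this quadratic is that of W regarded as a quadratic in p₀₁, hence equals q₀₁² where
W = 0, and z₊ = (B + q₀₁)/(2A) is a root. The required quotient of sines holds modulo the quadratic
(`shift_identity`); the symmetry σ₀ₜ ↔ σ₁ₜ, θ₀ ↔ θ₁ gives the other shift.

The quartic equation also controls ω₊. Since no ν_j - λ_k is an integer, no sine containing ω₊
vanishes. Since Σν_k = Σλ_k, the equation is an equality of two products of sines, which makes
`tetraFactor` 1-periodic in ω₊. It thus does not depend on the choice of ω₊, which can be made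
independently at each point because z₊ is invariant under the shifts. -/

noncomputable section

open Filter Topology

/-! ### The difference equation of Ĝ. -/

/-- The factors of the Weierstrass product of `G(1+x)`. -/
def barnesFactor (x : ℂ) (k : ℕ) : ℂ :=
  (1 + x / ((k : ℂ) + 1)) ^ (k + 1) * Complex.exp (x ^ 2 / (2 * ((k : ℂ) + 1)) - x)

lemma barnesG_one_add (x : ℂ) :
    barnesG (1 + x) = Complex.exp (x / 2 * (Real.log (2 * Real.pi) : ℂ)
      - (x + x ^ 2 * (1 + (Real.eulerMascheroniConstant : ℂ))) / 2) * ∏' k, barnesFactor x k := by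
  simp [barnesG, barnesFactor]

/-- The logarithms of the factors of the Weierstrass product of `G(1+x)`. -/
def barnesLogFactor (x : ℂ) (k : ℕ) : ℂ :=
  ((k : ℂ) + 1) * Complex.log (1 + x / ((k : ℂ) + 1)) + (x ^ 2 / (2 * ((k : ℂ) + 1)) - x)

lemma exp_barnesLogFactor {x : ℂ} {k : ℕ} (h : 1 + x / ((k : ℂ) + 1) ≠ 0) :
    Complex.exp (barnesLogFactor x k) = barnesFactor x k := by
  have := Complex.exp_nat_mul (Complex.log (1 + x / ((k : ℂ) + 1))) (k + 1)
  rw [Complex.exp_log h] at this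
  rw [barnesLogFactor, Complex.exp_add, barnesFactor, ← this]
  push_cast
  rfl

/-- The correction x²/(2(k+1)) - x cancels the Taylor terms of the logarithm through order two; the
cubic remainder times k+1 is O(1/(k+1)²). -/
lemma summable_barnesLogFactor (x : ℂ) : Summable (barnesLogFactor x) := by
  have hO := Complex.log_sub_logTaylor_isBigO 2
  have ht : Tendsto (fun k : ℕ => x / ((k : ℂ) + 1)) atTop (𝓝 0) := by
    have := (tendsto_one_div_add_atTop_nhds_zero_nat (𝕜 := ℂ)).const_mul x
    simpa [div_eq_mul_inv] using this
  have h1 := hO.comp_tendsto ht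
  have h2 := (Asymptotics.isBigO_refl (fun k : ℕ => (k : ℂ) + 1) atTop).mul h1
  have hs : Summable (fun k : ℕ => x ^ 3 * (1 / ((k : ℂ) + 1) ^ 2)) := by
    apply Summable.mul_left
    have := (summable_nat_add_iff 1).mpr (Real.summable_one_div_nat_pow.mpr (one_lt_two))
    simpa using Complex.ofRealCLM.summable this
  refine summable_of_isBigO_nat hs.norm ?_
  refine (h2.congr ?_ ?_).norm_right
  · intro k
    have hk : (k : ℂ) + 1 ≠ 0 := Nat.cast_add_one_ne_zero k
    simp [Complex.logTaylor_succ, Complex.logTaylor_zero, barnesLogFactor]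
    field_simp
    ring
  · intro k
    have hk : (k : ℂ) + 1 ≠ 0 := Nat.cast_add_one_ne_zero k
    simp
    field_simp

lemma hasProd_barnesFactor {x : ℂ} (h : ∀ k : ℕ, 1 + x / ((k : ℂ) + 1) ≠ 0) :
    HasProd (barnesFactor x) (Complex.exp (∑' k, barnesLogFactor x k)) := by
  have := (summable_barnesLogFactor x).hasSum.cexp
  exact this.congr_fun (fun k => (exp_barnesLogFactor (h k)).symm)

namespace PVI

lemma sinpi_neg (x : ℂ) : sinpi (-x) = -sinpi x := by simp [sinpi]

lemma sinpi_add_one (x : ℂ) : sinpi (x + 1) = -sinpi x := by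
  simp [sinpi, mul_add, Complex.sin_add_pi]

lemma ne_intCast_of_sinpi_ne_zero {x : ℂ} (h : sinpi x ≠ 0) (n : ℤ) : x ≠ n := by
  rintro rfl
  apply h
  rw [sinpi, mul_comm]
  exact Complex.sin_int_mul_pi n

lemma one_add_div_ne_zero {x : ℂ} (h : sinpi x ≠ 0) (k : ℕ) : 1 + x / ((k : ℂ) + 1) ≠ 0 := by
  have hk : (k : ℂ) + 1 ≠ 0 := Nat.cast_add_one_ne_zero k
  intro h0
  apply ne_intCast_of_sinpi_ne_zero h (-((k : ℤ) + 1))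
  field_simp at h0
  push_cast
  linear_combination h0

lemma barnesG_ne_zero {x : ℂ} (h : sinpi x ≠ 0) : barnesG (1 + x) ≠ 0 := by
  rw [barnesG_one_add, (hasProd_barnesFactor (one_add_div_ne_zero h)).tprod_eq]
  exact mul_ne_zero (Complex.exp_ne_zero _) (Complex.exp_ne_zero _)

lemma barnesGHat_ne_zero {x : ℂ} (h : sinpi x ≠ 0) : barnesGHat x ≠ 0 := by
  have h' : sinpi (-x) ≠ 0 := by rw [sinpi_neg]; exact neg_ne_zero.mpr h
  exact div_ne_zero (barnesG_ne_zero h) (by simpa [sub_eq_add_neg] using barnesG_ne_zero h')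

/-- The partial products of the Weierstrass product of `Ĝ`. -/
def ghatPartial (x : ℂ) (N : ℕ) : ℂ :=
  ∏ j ∈ Finset.range N, barnesFactor x j / barnesFactor (-x) j

/-- In G(1+x)/G(1-x) the terms even in x, including the one with Euler's constant, cancel from the
exponential prefactor. -/
lemma tendsto_ghatPartial {x : ℂ} (h : sinpi x ≠ 0) :
    Tendsto (fun N => Complex.exp (x * (Real.log (2 * Real.pi) : ℂ) - x) * ghatPartial x N) atTop
      (𝓝 (barnesGHat x)) := by
  have h' : sinpi (-x) ≠ 0 := by rw [sinpi_neg]; exact neg_ne_zero.mpr h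
  have h1 := (hasProd_barnesFactor (one_add_div_ne_zero h))
  have h2 := (hasProd_barnesFactor (one_add_div_ne_zero h'))
  have h3 := ((h1.tendsto_prod_nat.div h2.tendsto_prod_nat (Complex.exp_ne_zero _))).const_mul
    (Complex.exp (x * (Real.log (2 * Real.pi) : ℂ) - x))
  rw [barnesGHat, sub_eq_add_neg 1 x, barnesG_one_add, barnesG_one_add, h1.tprod_eq, h2.tprod_eq]
  convert h3 using 2
  · simp [ghatPartial, Finset.prod_div_distrib]
  · rw [mul_div_mul_comm, ← Complex.exp_sub]
    congr 2
    ring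

lemma barnesFactor_div (x : ℂ) (j : ℕ) :
    barnesFactor x j / barnesFactor (-x) j =
      (((j : ℂ) + 1 + x) / ((j : ℂ) + 1 - x)) ^ (j + 1) * Complex.exp (-2 * x) := by
  have hk : (j : ℂ) + 1 ≠ 0 := Nat.cast_add_one_ne_zero j
  rw [barnesFactor, barnesFactor, mul_div_mul_comm, ← Complex.exp_sub, ← div_pow]
  congr 2
  · rw [← mul_div_mul_left _ _ hk]
    congr 1 <;> field_simp
    ring
  · ring

/-- The partial products of Euler's product for `sin (π x) / (π x)`. -/
def eulerPartial (x : ℂ) (N : ℕ) : ℂ :=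
  ∏ j ∈ Finset.range N, ((1 : ℂ) - x ^ 2 / ((j : ℂ) + 1) ^ 2)

/-- The exponents telescope: in the quotient of the two partial products each of m + x (1 ≤ m ≤ N)
and m - x (0 ≤ m < N) keeps exponent -1, and only the boundary terms carry high powers. The factors
with 1 ≤ m ≤ N multiply to N!² times Euler's partial product, and m = 0 gives -x. -/
lemma ghatPartial_add_one {x : ℂ} (h : sinpi x ≠ 0) (N : ℕ) :
    ghatPartial (x + 1) N * (-x * (N.factorial : ℂ) ^ 2 * eulerPartial x N) =
      ghatPartial x N * (((N : ℂ) + 1 + x) ^ N * ((N : ℂ) - x) ^ (N + 1)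
        * Complex.exp (-2) ^ N) := by
  induction N with
  | zero => simp [ghatPartial, eulerPartial]
  | succ N ih =>
    have hk : (N : ℂ) + 1 ≠ 0 := Nat.cast_add_one_ne_zero N
    have h1 : (N : ℂ) + 1 - x ≠ 0 := by
      have := ne_intCast_of_sinpi_ne_zero h (N + 1)
      push_cast at this
      exact sub_ne_zero.mpr this.symm
    have h2 : (N : ℂ) - x ≠ 0 := by
      have := ne_intCast_of_sinpi_ne_zero h N
      push_cast at this
      exact sub_ne_zero.mpr this.symm
    have h3 : (N : ℂ) + 1 + x ≠ 0 := by
      have := ne_intCast_of_sinpi_ne_zero h (-(N + 1))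
      push_cast at this
      intro h0
      exact this (by linear_combination h0)
    have e1 : Complex.exp (-2 * (x + 1)) = Complex.exp (-2 * x) * Complex.exp (-2) := by
      rw [← Complex.exp_add]; ring_nf
    have hA : ghatPartial (x + 1) (N + 1) = ghatPartial (x + 1) N *
        ((((N : ℂ) + 2 + x) / ((N : ℂ) - x)) ^ (N + 1) *
          (Complex.exp (-2 * x) * Complex.exp (-2))) := by
      rw [ghatPartial, Finset.prod_range_succ, barnesFactor_div, e1, ghatPartial]
      ring_nf
    have hB : ghatPartial x (N + 1) = ghatPartial x N *
        ((((N : ℂ) + 1 + x) / ((N : ℂ) + 1 - x)) ^ (N + 1) * Complex.exp (-2 * x)) := by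
      rw [ghatPartial, Finset.prod_range_succ, barnesFactor_div, ghatPartial]
    have hC : eulerPartial x (N + 1) = eulerPartial x N *
        (((N : ℂ) + 1 + x) * ((N : ℂ) + 1 - x) / ((N : ℂ) + 1) ^ 2) := by
      rw [eulerPartial, Finset.prod_range_succ, eulerPartial]
      congr 1
      field_simp
      ring
    rw [hA, hB, hC, Nat.factorial_succ]
    push_cast
    rw [show (N : ℂ) + 1 + 1 + x = N + 2 + x by ring, div_pow, div_pow]
    generalize ghatPartial (x + 1) N = T' at *
    generalize ghatPartial x N = T at *
    generalize eulerPartial x N = E at *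
    generalize (N.factorial : ℂ) = f at *
    generalize Complex.exp (-2 * x) = e at *
    generalize Complex.exp (-2) = e' at *
    have h2' := pow_ne_zero (N + 1) h2
    have h1' := pow_ne_zero (N + 1) h1
    rw [pow_succ (_ - x) (N + 1)]
    have key := congrArg (fun u => u * (((N : ℂ) + 2 + x) ^ (N + 1) / ((N : ℂ) - x) ^ (N + 1) *
      (e * e') * (((N : ℂ) + 1 + x) * ((N : ℂ) + 1 - x)))) ih
    calc _ = T' * (-x * f ^ 2 * E) * (((N : ℂ) + 2 + x) ^ (N + 1) / ((N : ℂ) - x) ^ (N + 1) *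
      (e * e') * (((N : ℂ) + 1 + x) * ((N : ℂ) + 1 - x))) := by
          field_simp
      _ = _ := key
      _ = _ := by
          field_simp
          ring

lemma tendsto_eulerPartial {x : ℂ} (h : sinpi x ≠ 0) :
    Tendsto (eulerPartial x) atTop (𝓝 (sinpi x / (Real.pi * x))) := by
  have hpi : (Real.pi : ℂ) ≠ 0 := by exact_mod_cast Real.pi_ne_zero
  have hx : x ≠ 0 := by simpa using ne_intCast_of_sinpi_ne_zero h 0
  refine ((Complex.tendsto_euler_sin_prod x).div_const (Real.pi * x)).congr fun N => ?_
  rw [eulerPartial]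
  field_simp

lemma factorial_sq_eq_stirlingSeq {N : ℕ} (hN : N ≠ 0) :
    (N.factorial : ℂ) ^ 2 =
      (Stirling.stirlingSeq N : ℂ) ^ 2 * (2 * N) * (N ^ N * N ^ N) * Complex.exp (-2) ^ N := by
  have hN' : (0 : ℝ) < N := by positivity
  have h : (N.factorial : ℝ) ^ 2 =
      Stirling.stirlingSeq N ^ 2 * (2 * N) * (N ^ N * N ^ N) * Real.exp (-2) ^ N := by
    have he : Real.exp (-2) = (Real.exp 1)⁻¹ ^ 2 := by
      rw [← Real.exp_neg, ← Real.exp_nat_mul]; norm_num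
    rw [Stirling.stirlingSeq, he, ← pow_mul, mul_comm 2 N, pow_mul]
    have hs : √(2 * (N : ℝ)) ^ 2 = 2 * N := Real.sq_sqrt (by positivity)
    have hs0 : √(2 * (N : ℝ)) ≠ 0 := by positivity
    rw [div_pow, mul_pow, hs, div_pow, inv_pow]
    field_simp
  have := congrArg (fun r : ℝ => (r : ℂ)) h
  push_cast at this
  exact this

/-- With the powers of N taken out, the numerator tends to e^{1+x} e^{-x} = e. Stirling's formula
for N!² leaves 2π in the denominator, next to -x and the limit sin πx / (πx). -/
lemma tendsto_ghatPartial_ratio {x : ℂ} (h : sinpi x ≠ 0) :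
    Tendsto (fun N : ℕ => (((N : ℂ) + 1 + x) ^ N * ((N : ℂ) - x) ^ (N + 1) * Complex.exp (-2) ^ N)
      / (-x * (N.factorial : ℂ) ^ 2 * eulerPartial x N)) atTop
      (𝓝 (-Complex.exp 1 / (2 * sinpi x))) := by
  have hpi : (Real.pi : ℂ) ≠ 0 := by exact_mod_cast Real.pi_ne_zero
  have hx : x ≠ 0 := by simpa using ne_intCast_of_sinpi_ne_zero h 0
  have hst : Tendsto (fun N => (Stirling.stirlingSeq N : ℂ) ^ 2) atTop (𝓝 (Real.pi : ℂ)) := by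
    have := (Complex.continuous_ofReal.tendsto _).comp (Stirling.tendsto_stirlingSeq_sqrt_pi.pow 2)
    rw [Real.sq_sqrt Real.pi_pos.le] at this
    exact this.congr fun N => by simp
  have h1 := Complex.tendsto_one_add_div_pow_exp (1 + x)
  have h2 := Complex.tendsto_one_add_div_pow_exp (-x)
  have h3 : Tendsto (fun N : ℕ => 1 + -x / (N : ℂ)) atTop (𝓝 (1 + 0)) :=
    (tendsto_const_div_atTop_nhds_zero_nat (-x)).const_add 1
  have h4 := ((h1.mul h2).mul h3).div
    (((hst.const_mul 2).const_mul (-x)).mul (tendsto_eulerPartial h)) (by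
      refine mul_ne_zero (mul_ne_zero (neg_ne_zero.mpr hx) (by simp [Real.pi_ne_zero]))
        (div_ne_zero h (mul_ne_zero hpi hx)))
  have hlim : Complex.exp (1 + x) * Complex.exp (-x) * (1 + 0) /
      (-x * (2 * (Real.pi : ℂ)) * (sinpi x / (Real.pi * x))) =
      -Complex.exp 1 / (2 * sinpi x) := by
    rw [← Complex.exp_add, add_assoc, add_neg_cancel, add_zero]
    field_simp
  rw [hlim] at h4
  refine h4.congr' ?_
  filter_upwards [eventually_ne_atTop 0] with N hN
  have hN' : (N : ℂ) ≠ 0 := by exact_mod_cast hN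
  have e1 : (N : ℂ) + 1 + x = N * (1 + (1 + x) / N) := by field_simp; ring
  have e2 : (N : ℂ) - x = N * (1 + -x / N) := by field_simp; ring
  rw [factorial_sq_eq_stirlingSeq hN, e1, e2, mul_pow, mul_pow, pow_succ, pow_succ]
  simp only [Pi.div_apply]
  have hp := pow_ne_zero N hN'
  have he := pow_ne_zero N (Complex.exp_ne_zero (-2))
  generalize (1 + (1 + x) / (N : ℂ)) ^ N = u
  generalize (1 + -x / (N : ℂ)) ^ N = v
  generalize (1 + -x / (N : ℂ)) = w
  generalize (N : ℂ) ^ N = M at *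
  generalize Complex.exp (-2) ^ N = e at *
  rw [show -x * ((Stirling.stirlingSeq N : ℂ) ^ 2 * (2 * N) * (M * M) * e) * eulerPartial x N =
    (-x * (2 * (Stirling.stirlingSeq N : ℂ) ^ 2) * eulerPartial x N) * (N * M * M * e) by ring,
    show M * u * (M * N * (v * w)) * e = (u * v * w) * (N * M * M * e) by ring]
  exact (mul_div_mul_right _ _ (by simp [*])).symm

/-- The difference equation `Ĝ(x+1) = -(π / sin πx) Ĝ(x)`. -/
theorem barnesGHat_add_one {x : ℂ} (h : sinpi x ≠ 0) :
    barnesGHat (x + 1) = -(Real.pi / sinpi x) * barnesGHat x := by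
  have hpi : (Real.pi : ℂ) ≠ 0 := by exact_mod_cast Real.pi_ne_zero
  have h' : sinpi (x + 1) ≠ 0 := by rw [sinpi_add_one]; exact neg_ne_zero.mpr h
  have hx : x ≠ 0 := by simpa using ne_intCast_of_sinpi_ne_zero h 0
  have hl : Complex.exp (Real.log (2 * Real.pi) : ℂ) = 2 * Real.pi := by
    rw [← Complex.ofReal_exp, Real.exp_log Real.two_pi_pos]
    push_cast
    rfl
  -- The constant 2π/e is the factor exp(log 2π - 1) gained by the exponential prefactor under x ↦ x
  -- + 1.
  have t1 := (tendsto_ghatPartial h).mul ((tendsto_ghatPartial_ratio h).const_mul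
    (2 * (Real.pi : ℂ) * Complex.exp (-1)))
  have hlim : barnesGHat x * (2 * (Real.pi : ℂ) * Complex.exp (-1) *
      (-Complex.exp 1 / (2 * sinpi x))) = -(Real.pi / sinpi x) * barnesGHat x := by
    rw [Complex.exp_neg]
    have := Complex.exp_ne_zero 1
    field_simp
  rw [hlim] at t1
  refine tendsto_nhds_unique ((tendsto_ghatPartial h').congr fun N => ?_) t1
  have hE : eulerPartial x N ≠ 0 := by
    refine Finset.prod_ne_zero_iff.mpr fun j _ => ?_
    have hj : (j : ℂ) + 1 ≠ 0 := Nat.cast_add_one_ne_zero j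
    have h1 := one_add_div_ne_zero h j
    have h2 := one_add_div_ne_zero (x := -x) (by rw [sinpi_neg]; exact neg_ne_zero.mpr h) j
    convert mul_ne_zero h1 h2 using 1
    field_simp
    ring
  have hD : -x * (N.factorial : ℂ) ^ 2 * eulerPartial x N ≠ 0 :=
    mul_ne_zero (mul_ne_zero (neg_ne_zero.mpr hx) (by simp [Nat.factorial_ne_zero])) hE
  rw [eq_div_of_mul_eq hD (ghatPartial_add_one h N),
    show (x + 1) * (Real.log (2 * Real.pi) : ℂ) - (x + 1) =
      (x * (Real.log (2 * Real.pi) : ℂ) - x) + ((Real.log (2 * Real.pi) : ℂ) + -1) by ring,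
    Complex.exp_add, Complex.exp_add (Real.log (2 * Real.pi) : ℂ), hl]
  ring

/-! ### Algebra of the quadratic equation for z₊. -/

/-- `u + 1/u`, the trace of a matrix in `SL₂` with eigenvalues `u` and `1/u`. -/
def eigTr (u : ℂ) : ℂ := u + u⁻¹

/-- Leading coefficient of the quadratic equation for `z₊`. -/
def quadA (X Y a b c d : ℂ) : ℂ :=
  Y * c * d + Y * a * b + X * b * c + X * a * d - X * Y - b * d - a * c - X * Y * a * b * c * d

/-- Middle coefficient, up to sign, of the quadratic equation for `z₊`. -/
def quadB (X Y a b c d : ℂ) : ℂ :=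
  -(X - X⁻¹) * (Y - Y⁻¹) - (a - a⁻¹) * (c - c⁻¹) - (b - b⁻¹) * (d - d⁻¹)

/-- Constant coefficient of the quadratic equation for `z₊`. -/
def quadC (X Y a b c d : ℂ) : ℂ := quadA X⁻¹ Y⁻¹ a⁻¹ b⁻¹ c⁻¹ d⁻¹

section
variable {X Y a b c d : ℂ} (hX : X ≠ 0) (hY : Y ≠ 0) (ha : a ≠ 0) (hb : b ≠ 0) (hc : c ≠ 0)
  (hd : d ≠ 0)
include hX hY ha hb hc hd

/-- The right side is the discriminant of W as a quadratic polynomial in p₀₁, which differs from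
(∂W/∂p₀₁)² by 4W. -/
lemma quad_discrim :
    quadB X Y a b c d ^ 2 - 4 * quadA X Y a b c d * quadC X Y a b c d =
      (eigTr X * eigTr Y - (eigTr a * eigTr c + eigTr b * eigTr d)) ^ 2
        - 4 * (eigTr X ^ 2 + eigTr Y ^ 2 - (eigTr a * eigTr b + eigTr c * eigTr d) * eigTr X
          - (eigTr b * eigTr c + eigTr a * eigTr d) * eigTr Y
          + (eigTr a * eigTr b * eigTr c * eigTr d
            + (eigTr a ^ 2 + eigTr b ^ 2 + eigTr c ^ 2 + eigTr d ^ 2)) - 4) := by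
  simp only [quadA, quadB, quadC, eigTr]
  field_simp
  ring

/-- Both quartics in z have constant term 1 and leading coefficient (XYabcd)², so only degrees 1 to
3 survive. -/
lemma quad_eq_prod_sub (z : ℂ) :
    (1 - z * (X * a * b)) * (1 - z * (X * c * d)) * (1 - z * (Y * a * d)) * (1 - z * (Y * b * c))
      - (1 - z * (a * b * c * d)) * (1 - z * (X * Y * a * c)) * (1 - z * (X * Y * b * d)) * (1 - z)
      = -(X * Y * a * b * c * d) * z *
        (quadA X Y a b c d * z ^ 2 - quadB X Y a b c d * z + quadC X Y a b c d) := by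
  simp only [quadA, quadB, quadC]
  field_simp
  ring

/-- The algebraic core of both difference equations: the two sides differ by an explicit multiple of
the quadratic. Here q and q' stand for q₀₁ and q₁ₜ, and `hq'` is the definition of q₁ₜ with p₀₁
eliminated in favour of q₀₁. -/
lemma shift_identity {z q q' : ℂ}
    (hz : quadA X Y a b c d * z ^ 2 - quadB X Y a b c d * z + quadC X Y a b c d = 0)
    (hq : q = 2 * quadA X Y a b c d * z - quadB X Y a b c d)
    (hq' : 2 * q' = 4 * eigTr Y
      + eigTr X * (q - eigTr X * eigTr Y + (eigTr a * eigTr c + eigTr b * eigTr d))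
      - 2 * (eigTr b * eigTr c + eigTr a * eigTr d)) :
    (1 - z * (X * Y * a * c)) * (1 - z * (X * Y * b * d)) *
        ((eigTr (a * b) - eigTr X) * (eigTr (c * d) - eigTr X)) =
      Y * (q * X⁻¹ - q') * ((1 - z * (X * a * b)) * (1 - z * (X * c * d))) := by
  have key : (1 - z * (X * Y * a * c)) * (1 - z * (X * Y * b * d)) *
        ((eigTr (a * b) - eigTr X) * (eigTr (c * d) - eigTr X)) -
      Y * (q * X⁻¹ - q') * ((1 - z * (X * a * b)) * (1 - z * (X * c * d))) =
      (quadA X Y a b c d * z ^ 2 - quadB X Y a b c d * z + quadC X Y a b c d) *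
      (Y * (X - X⁻¹) * X ^ 2 * a * b * c * d * z - Y * (X * (a * b * c * d + 1) - a * b - c * d)) := by
    have h2 : q' = (4 * eigTr Y
      + eigTr X * (q - eigTr X * eigTr Y + (eigTr a * eigTr c + eigTr b * eigTr d))
      - 2 * (eigTr b * eigTr c + eigTr a * eigTr d)) / 2 := by rw [← hq']; ring
    rw [h2, hq]
    simp only [quadA, quadB, quadC, eigTr]
    field_simp
    ring
  rw [hz, zero_mul] at key
  exact sub_eq_zero.mp key

end

/-! ### Translation between sines, traces and exponentials. -/

lemma prod_signs (f : ℂ → ℂ) : ∏ ε ∈ signs, f ε = f 1 * f (-1) := by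
  have h : (1 : ℂ) ≠ -1 := by norm_num
  rw [signs, Finset.prod_pair h]

lemma one_mem_signs : (1 : ℂ) ∈ signs := by simp [signs]

lemma neg_one_mem_signs : (-1 : ℂ) ∈ signs := by simp [signs]

lemma e2pi_add (u v : ℂ) : e2pi (u + v) = e2pi u * e2pi v := by
  simp only [e2pi, mul_add, Complex.exp_add]

lemma e2pi_neg (u : ℂ) : e2pi (-u) = (e2pi u)⁻¹ := by
  simp only [e2pi, mul_neg, Complex.exp_neg]

lemma e2pi_sub (u v : ℂ) : e2pi (u - v) = e2pi u * (e2pi v)⁻¹ := by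
  rw [sub_eq_add_neg, e2pi_add, e2pi_neg]

lemma e2pi_zero : e2pi 0 = 1 := by simp [e2pi]

lemma e2pi_ne_zero (u : ℂ) : e2pi u ≠ 0 := Complex.exp_ne_zero _

lemma e2pi_eq_one_iff {u : ℂ} : e2pi u = 1 ↔ ∃ n : ℤ, u = n := by
  rw [e2pi, Complex.exp_eq_one_iff]
  have h : 2 * (Real.pi : ℂ) * Complex.I ≠ 0 := Complex.two_pi_I_ne_zero
  refine exists_congr fun n => ?_
  rw [mul_comm (n : ℂ), mul_right_inj' h]

lemma e2pi_add_one (u : ℂ) : e2pi (u + 1) = e2pi u := by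
  rw [e2pi_add, e2pi_eq_one_iff (u := 1) |>.mpr ⟨1, by simp⟩, mul_one]

lemma e2pi_ne_one {u : ℂ} (h : sinpi u ≠ 0) : e2pi u ≠ 1 := fun h1 => by
  obtain ⟨n, hn⟩ := e2pi_eq_one_iff.mp h1
  exact ne_intCast_of_sinpi_ne_zero h n hn

lemma sinpi_ne_zero {u : ℂ} (h : e2pi u ≠ 1) : sinpi u ≠ 0 := fun h0 => by
  obtain ⟨n, hn⟩ := Complex.sin_eq_zero_iff.mp h0
  have hpi : (Real.pi : ℂ) ≠ 0 := by exact_mod_cast Real.pi_ne_zero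
  refine h (e2pi_eq_one_iff.mpr ⟨n, mul_left_cancel₀ hpi ?_⟩)
  rw [hn, mul_comm]

/-- `e^{π i x}`. -/
def halfExp (x : ℂ) : ℂ := Complex.exp ((Real.pi : ℂ) * Complex.I * x)

lemma halfExp_ne_zero (x : ℂ) : halfExp x ≠ 0 := Complex.exp_ne_zero _

lemma halfExp_add (u v : ℂ) : halfExp (u + v) = halfExp u * halfExp v := by
  simp only [halfExp, mul_add, Complex.exp_add]

lemma halfExp_sq (u : ℂ) : halfExp u ^ 2 = e2pi u := by
  rw [halfExp, ← Complex.exp_nat_mul, e2pi]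
  congr 1
  push_cast
  ring

lemma two_I_mul_sinpi_mul_halfExp (u : ℂ) :
    2 * Complex.I * sinpi u * halfExp u = e2pi u - 1 := by
  have h := Complex.two_sin ((Real.pi : ℂ) * u)
  have h1 : Complex.exp (-((Real.pi : ℂ) * u) * Complex.I) = (halfExp u)⁻¹ := by
    rw [halfExp, ← Complex.exp_neg]; ring_nf
  have h2 : Complex.exp ((Real.pi : ℂ) * u * Complex.I) = halfExp u := by
    rw [halfExp]; ring_nf
  rw [h1, h2] at h
  rw [← halfExp_sq, sinpi, show 2 * Complex.I * Complex.sin (Real.pi * u) * halfExp u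
    = Complex.I * (2 * Complex.sin (Real.pi * u)) * halfExp u by ring, h]
  have := halfExp_ne_zero u
  field_simp
  rw [Complex.I_sq]
  ring

lemma sinpi_mul_sinpi (u v : ℂ) :
    -4 * (sinpi u * sinpi v) * halfExp (u + v) = (1 - e2pi u) * (1 - e2pi v) := by
  rw [halfExp_add]
  linear_combination (e2pi v - 1) * two_I_mul_sinpi_mul_halfExp u
    + (2 * Complex.I * sinpi u * halfExp u) * two_I_mul_sinpi_mul_halfExp v
    - 4 * sinpi u * sinpi v * halfExp u * halfExp v * Complex.I_sq

lemma tr_eq (u : ℂ) : tr u = eigTr (e2pi u) := by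
  rw [tr, Complex.two_cos, eigTr, ← e2pi_neg, e2pi, e2pi]
  congr 2 <;> ring

lemma four_mul_sinpi_add_mul_sinpi_sub (u v : ℂ) :
    4 * (sinpi (u + v) * sinpi (u - v)) = tr v - tr u := by
  have h1 : tr v = 2 * Complex.cos (Real.pi * (u + v) - Real.pi * (u - v)) := by
    rw [tr]; ring_nf
  have h2 : tr u = 2 * Complex.cos (Real.pi * (u + v) + Real.pi * (u - v)) := by
    rw [tr]; ring_nf
  rw [h1, h2, Complex.cos_add, Complex.cos_sub, sinpi, sinpi]
  ring

lemma sinpi_two_mul (u : ℂ) :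
    2 * Complex.I * sinpi (2 * u) = e2pi u - (e2pi u)⁻¹ := by
  have h := two_I_mul_sinpi_mul_halfExp (2 * u)
  have h1 : halfExp (2 * u) = e2pi u := by
    rw [two_mul, halfExp_add, ← sq, halfExp_sq]
  rw [h1, two_mul u, e2pi_add, ← two_mul] at h
  have := e2pi_ne_zero u
  field_simp
  linear_combination h

lemma four_mul_sinpi_two_mul (u v : ℂ) :
    4 * sinpi (2 * u) * sinpi (2 * v) =
      -(e2pi u - (e2pi u)⁻¹) * (e2pi v - (e2pi v)⁻¹) := by
  rw [← sinpi_two_mul, ← sinpi_two_mul]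
  linear_combination 4 * sinpi (2 * u) * sinpi (2 * v) * Complex.I_sq

/-- Pairs a factor of the denominator of Jimbo's formula for δ = 1 with its counterpart for δ = -1;
the product is a polynomial in the traces. -/
lemma tr_sub_mul_tr_sub (r u v : ℂ) :
    (r - tr (u - v)) * (r - tr (u + v)) =
      tr v ^ 2 + r ^ 2 + tr u ^ 2 - r * tr u * tr v - 4 := by
  simp only [tr_eq, e2pi_add, e2pi_sub, eigTr]
  have := e2pi_ne_zero u
  have := e2pi_ne_zero v
  field_simp
  ring

/-! ### The quadratic at a point of the cubic surface. -/

/-- The leading coefficient of the quadratic equation at a point. -/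
def pointQuadA (θ : Params) (P : Point) : ℂ :=
  quadA (e2pi P.s0) (e2pi P.s1) (e2pi θ.th0) (e2pi θ.tht) (e2pi θ.th1) (e2pi θ.thinf)

/-- The middle coefficient, up to sign, of the quadratic equation at a point. -/
def pointQuadB (θ : Params) (P : Point) : ℂ :=
  quadB (e2pi P.s0) (e2pi P.s1) (e2pi θ.th0) (e2pi θ.tht) (e2pi θ.th1) (e2pi θ.thinf)

/-- The constant coefficient of the quadratic equation at a point. -/
def pointQuadC (θ : Params) (P : Point) : ℂ :=
  quadC (e2pi P.s0) (e2pi P.s1) (e2pi θ.th0) (e2pi θ.tht) (e2pi θ.th1) (e2pi θ.thinf)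

lemma nuSigma_eq (θ : Params) (P : Point) :
    nuSigma θ P = P.s0 + P.s1 + θ.th0 + θ.tht + θ.th1 + θ.thinf := by
  simp [nuSigma, nu, Fin.sum_univ_four]
  ring

lemma zDen_eq (θ : Params) (P : Point) : zDen θ P = 2 * pointQuadA θ P := by
  rw [zDen, nuSigma_eq]
  simp only [nu, lam, Fin.sum_univ_four, Matrix.cons_val, pointQuadA, quadA, e2pi_add, e2pi_sub,
    e2pi_zero]
  have := e2pi_ne_zero P.s0
  have := e2pi_ne_zero P.s1
  have := e2pi_ne_zero θ.th0
  have := e2pi_ne_zero θ.tht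
  have := e2pi_ne_zero θ.th1
  have := e2pi_ne_zero θ.thinf
  field_simp
  ring

lemma zNum_eq (θ : Params) (P : Point) : zNum θ P = pointQuadB θ P + q01 θ P := by
  rw [zNum, four_mul_sinpi_two_mul, four_mul_sinpi_two_mul, four_mul_sinpi_two_mul, pointQuadB,
    quadB]
  ring

lemma pointQuad_discrim {θ : Params} {P : Point} (hP : P ∈ monodromySpace θ) :
    pointQuadB θ P ^ 2 - 4 * pointQuadA θ P * pointQuadC θ P = q01 θ P ^ 2 := by
  have hW : cubicW θ (tr P.s0) (tr P.s1) P.p01 = 0 := hP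
  rw [pointQuadA, pointQuadB, pointQuadC, quad_discrim (e2pi_ne_zero _) (e2pi_ne_zero _)
    (e2pi_ne_zero _) (e2pi_ne_zero _) (e2pi_ne_zero _) (e2pi_ne_zero _)]
  simp only [← tr_eq]
  rw [cubicW, omega0t, omega1t, omega01, omega4] at hW
  rw [q01, omega01]
  linear_combination -4 * hW

lemma q01_eq {θ : Params} {P : Point} (hA : zDen θ P ≠ 0) :
    q01 θ P = 2 * pointQuadA θ P * zPlus θ P - pointQuadB θ P := by
  have h := div_mul_cancel₀ (zNum θ P) hA
  rw [← zPlus, zDen_eq, zNum_eq] at h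
  linear_combination -h

/-- Completing the square: 4A(Az² - Bz + C) = (2Az - B)² - (B² - 4AC), and both squares equal q₀₁².
-/
lemma zPlus_quadratic {θ : Params} {P : Point} (hP : P ∈ monodromySpace θ) (hA : zDen θ P ≠ 0) :
    pointQuadA θ P * zPlus θ P ^ 2 - pointQuadB θ P * zPlus θ P + pointQuadC θ P = 0 := by
  have hA' : pointQuadA θ P ≠ 0 := by
    intro h
    rw [zDen_eq, h, mul_zero] at hA
    exact hA rfl
  have h := pointQuad_discrim hP
  rw [q01_eq hA] at h
  refine mul_left_cancel₀ (mul_ne_zero (by norm_num : (4 : ℂ) ≠ 0) hA') ?_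
  linear_combination -h

lemma tetraEq_zPlus {θ : Params} {P : Point} (hP : P ∈ monodromySpace θ) (hA : zDen θ P ≠ 0) :
    TetraEq θ P (zPlus θ P) := by
  have h := quad_eq_prod_sub (e2pi_ne_zero P.s0) (e2pi_ne_zero P.s1)
    (e2pi_ne_zero θ.th0) (e2pi_ne_zero θ.tht) (e2pi_ne_zero θ.th1) (e2pi_ne_zero θ.thinf)
    (zPlus θ P)
  have hz := zPlus_quadratic hP hA
  rw [pointQuadA, pointQuadB, pointQuadC] at hz
  rw [hz, mul_zero, sub_eq_zero] at h
  simp only [TetraEq, nu, lam, Fin.prod_univ_four, Matrix.cons_val, e2pi_add, e2pi_zero]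
  linear_combination h

/-! ### Jimbo's formulas and the quotients of sines. -/

/-- The denominator of `s₀ₜ^δ`. -/
def jimboDen0 (θ : Params) (δ : ℂ) (P : Point) : ℂ :=
  16 * ∏ ε ∈ signs, sinpi (θ.tht - δ * P.s0 + ε * θ.th0) *
      sinpi (θ.th1 - δ * P.s0 + ε * θ.thinf)

/-- The denominator of `s₁ₜ^δ`. -/
def jimboDen1 (θ : Params) (δ : ℂ) (P : Point) : ℂ :=
  16 * ∏ ε ∈ signs, sinpi (θ.tht - δ * P.s1 + ε * θ.th1) *
      sinpi (θ.th0 - δ * P.s1 + ε * θ.thinf)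

lemma jimboDen0_eq (θ : Params) (δ : ℂ) (P : Point) :
    jimboDen0 θ δ P =
      (tr θ.th0 - tr (θ.tht - δ * P.s0)) * (tr θ.thinf - tr (θ.th1 - δ * P.s0)) := by
  rw [← four_mul_sinpi_add_mul_sinpi_sub, ← four_mul_sinpi_add_mul_sinpi_sub, jimboDen0,
    prod_signs]
  simp only [one_mul, neg_mul, ← sub_eq_add_neg]
  ring

lemma jimboDen1_eq (θ : Params) (δ : ℂ) (P : Point) :
    jimboDen1 θ δ P =
      (tr θ.th1 - tr (θ.tht - δ * P.s1)) * (tr θ.thinf - tr (θ.th0 - δ * P.s1)) := by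
  rw [← four_mul_sinpi_add_mul_sinpi_sub, ← four_mul_sinpi_add_mul_sinpi_sub, jimboDen1,
    prod_signs]
  simp only [one_mul, neg_mul, ← sub_eq_add_neg]
  ring

namespace IsGeneric

variable {θ : Params} {P : Point}

lemma jimboDen0_ne_zero (h : IsGeneric θ P) {δ : ℂ} (hδ : -δ ∈ signs) : jimboDen0 θ δ P ≠ 0 := by
  refine mul_ne_zero (by norm_num) (Finset.prod_ne_zero_iff.mpr fun ε hε => mul_ne_zero ?_ ?_)
  · convert h.sin_0t ε hε _ hδ using 2; ring
  · convert h.sin_1inf ε hε _ hδ using 2; ring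

lemma jimboDen1_ne_zero (h : IsGeneric θ P) {δ : ℂ} (hδ : -δ ∈ signs) : jimboDen1 θ δ P ≠ 0 := by
  refine mul_ne_zero (by norm_num) (Finset.prod_ne_zero_iff.mpr fun ε hε => mul_ne_zero ?_ ?_)
  · convert h.sin_t1 ε hε _ hδ using 2; ring
  · convert h.sin_0inf ε hε _ hδ using 2; ring

/-- At fixed p₀ₜ, W is a conic in (p₁ₜ, p₀₁) with gradient (q₁ₜ, q₀₁). Completing the square shows
that q₀₁² - p₀ₜ q₀₁ q₁ₜ + q₁ₜ², the product of the numerators, is (4 - p₀ₜ²)W plus a function of p₀ₜ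
and θ alone, and that function is the product of the denominators. -/
lemma jimbo0_mul (h : IsGeneric θ P) (hP : P ∈ monodromySpace θ) :
    jimbo0 θ (-1) P * s0t θ P = 1 := by
  have hD : jimboDen0 θ (-1) P ≠ 0 := h.jimboDen0_ne_zero (by simp [signs])
  have hD' : jimboDen0 θ 1 P ≠ 0 := h.jimboDen0_ne_zero (by simp [signs])
  have hW : cubicW θ (tr P.s0) (tr P.s1) P.p01 = 0 := hP
  rw [s0t, jimbo0, jimbo0, ← jimboDen0, ← jimboDen0, div_mul_div_comm,
    div_eq_one_iff_eq (mul_ne_zero hD hD')]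
  have h1 := tr_sub_mul_tr_sub (tr θ.th0) θ.tht P.s0
  have h2 := tr_sub_mul_tr_sub (tr θ.thinf) θ.th1 P.s0
  have hx : tr P.s0 = e2pi P.s0 + (e2pi P.s0)⁻¹ := tr_eq _
  have hx' : e2pi P.s0 * (e2pi P.s0)⁻¹ = 1 := mul_inv_cancel₀ (e2pi_ne_zero _)
  rw [jimboDen0_eq, jimboDen0_eq]
  simp only [neg_mul, one_mul, sub_neg_eq_add, e2pi_neg]
  calc _ = q01 θ P ^ 2 - tr P.s0 * q01 θ P * q1t θ P + q1t θ P ^ 2 := by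
        linear_combination q01 θ P ^ 2 * hx' + q01 θ P * q1t θ P * hx
    _ = (tr P.s0 ^ 2 + tr θ.th0 ^ 2 + tr θ.tht ^ 2 - tr θ.th0 * tr θ.tht * tr P.s0 - 4) *
        (tr P.s0 ^ 2 + tr θ.thinf ^ 2 + tr θ.th1 ^ 2 - tr θ.thinf * tr θ.th1 * tr P.s0 - 4) := by
        rw [cubicW, omega0t, omega1t, omega01, omega4] at hW
        rw [q01, q1t, omega01, omega1t]
        linear_combination (4 - tr P.s0 ^ 2) * hW
    _ = _ := by rw [← h1, ← h2]; ring

lemma jimbo1_mul (h : IsGeneric θ P) (hP : P ∈ monodromySpace θ) :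
    jimbo1 θ (-1) P * s1t θ P = 1 := by
  have hD : jimboDen1 θ (-1) P ≠ 0 := h.jimboDen1_ne_zero (by simp [signs])
  have hD' : jimboDen1 θ 1 P ≠ 0 := h.jimboDen1_ne_zero (by simp [signs])
  have hW : cubicW θ (tr P.s0) (tr P.s1) P.p01 = 0 := hP
  rw [s1t, jimbo1, jimbo1, ← jimboDen1, ← jimboDen1, div_mul_div_comm,
    div_eq_one_iff_eq (mul_ne_zero hD hD')]
  have h1 := tr_sub_mul_tr_sub (tr θ.th1) θ.tht P.s1
  have h2 := tr_sub_mul_tr_sub (tr θ.thinf) θ.th0 P.s1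
  have hx : tr P.s1 = e2pi P.s1 + (e2pi P.s1)⁻¹ := tr_eq _
  have hx' : e2pi P.s1 * (e2pi P.s1)⁻¹ = 1 := mul_inv_cancel₀ (e2pi_ne_zero _)
  rw [jimboDen1_eq, jimboDen1_eq]
  simp only [neg_mul, one_mul, sub_neg_eq_add, e2pi_neg, neg_neg]
  calc _ = q01 θ P ^ 2 - tr P.s1 * q01 θ P * q0t θ P + q0t θ P ^ 2 := by
        linear_combination q01 θ P ^ 2 * hx' + q01 θ P * q0t θ P * hx
    _ = (tr P.s1 ^ 2 + tr θ.th1 ^ 2 + tr θ.tht ^ 2 - tr θ.th1 * tr θ.tht * tr P.s1 - 4) *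
        (tr P.s1 ^ 2 + tr θ.thinf ^ 2 + tr θ.th0 ^ 2 - tr θ.thinf * tr θ.th0 * tr P.s1 - 4) := by
        rw [cubicW, omega0t, omega1t, omega01, omega4] at hW
        rw [q01, q0t, omega01, omega0t]
        linear_combination (4 - tr P.s1 ^ 2) * hW
    _ = _ := by rw [← h1, ← h2]; ring

/-- The quotient of sines produced by the shift `σ₀ₜ ↦ σ₀ₜ + 1` equals `s₀ₜ⁻¹`. -/
lemma sinpi_ratio_shift0 (h : IsGeneric θ P) (hP : P ∈ monodromySpace θ) {w : ℂ}
    (hw : e2pi w = zPlus θ P) :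
    sinpi (w + lam θ P 1) * sinpi (w + lam θ P 2) *
        (sinpi (P.s0 - θ.tht - θ.th0) * sinpi (P.s0 - θ.th1 - θ.thinf)) =
      jimbo0 θ (-1) P * (sinpi (P.s0 + θ.tht - θ.th0) * sinpi (P.s0 + θ.th1 - θ.thinf)) *
        (sinpi (w + nu θ P 0) * sinpi (w + nu θ P 1)) := by
  have hD : jimboDen0 θ (-1) P ≠ 0 := h.jimboDen0_ne_zero (by simp [signs])
  have key := shift_identity (e2pi_ne_zero P.s0) (e2pi_ne_zero P.s1)
    (e2pi_ne_zero θ.th0) (e2pi_ne_zero θ.tht) (e2pi_ne_zero θ.th1) (e2pi_ne_zero θ.thinf)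
    (zPlus_quadratic hP h.den) (q01_eq h.den) (q' := q1t θ P) (by
      simp only [← tr_eq]
      rw [q1t, q01, omega1t, omega01]
      ring)
  rw [← hw] at key
  simp only [← e2pi_add, ← tr_eq] at key
  rw [← four_mul_sinpi_add_mul_sinpi_sub, ← four_mul_sinpi_add_mul_sinpi_sub] at key
  have s1 := sinpi_mul_sinpi (w + lam θ P 1) (w + lam θ P 2)
  have s2 := sinpi_mul_sinpi (w + nu θ P 0) (w + nu θ P 1)
  -- λ₂ + λ₃ - ν₁ - ν₂ = 2σ₁ₜ, so the half exponentials account exactly for the factor Y in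
  -- `shift_identity`.
  have hh : halfExp (w + lam θ P 1 + (w + lam θ P 2)) =
      halfExp (w + nu θ P 0 + (w + nu θ P 1)) * e2pi P.s1 := by
    rw [← halfExp_sq, sq, ← halfExp_add, ← halfExp_add]
    congr 1
    simp only [nu, lam, Matrix.cons_val]
    ring
  have hJ : jimbo0 θ (-1) P * jimboDen0 θ (-1) P = q01 θ P * (e2pi P.s0)⁻¹ - q1t θ P := by
    rw [jimbo0, ← jimboDen0, div_mul_cancel₀ _ hD, neg_one_mul, e2pi_neg]
  have hDe : jimboDen0 θ (-1) P = 16 *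
      (sinpi (P.s0 + (θ.th0 + θ.tht)) * sinpi (P.s0 + (θ.th1 + θ.thinf))) *
      (sinpi (P.s0 + θ.tht - θ.th0) * sinpi (P.s0 + θ.th1 - θ.thinf)) := by
    rw [jimboDen0, prod_signs,
      show θ.tht - -1 * P.s0 + 1 * θ.th0 = P.s0 + (θ.th0 + θ.tht) by ring,
      show θ.th1 - -1 * P.s0 + 1 * θ.thinf = P.s0 + (θ.th1 + θ.thinf) by ring,
      show θ.tht - -1 * P.s0 + -1 * θ.th0 = P.s0 + θ.tht - θ.th0 by ring,
      show θ.th1 - -1 * P.s0 + -1 * θ.thinf = P.s0 + θ.th1 - θ.thinf by ring]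
    ring
  rw [hDe] at hD hJ
  have hp := left_ne_zero_of_mul hD
  rw [hh] at s1
  rw [show w + (P.s0 + P.s1 + θ.th0 + θ.th1) = w + lam θ P 1 by simp [lam],
    show w + (P.s0 + P.s1 + θ.tht + θ.thinf) = w + lam θ P 2 by simp [lam], ← s1,
    show w + (P.s0 + θ.th0 + θ.tht) = w + nu θ P 0 by simp [nu],
    show w + (P.s0 + θ.th1 + θ.thinf) = w + nu θ P 1 by simp [nu], ← s2, ← hJ] at key
  have hY := e2pi_ne_zero P.s1
  have hH := halfExp_ne_zero (w + nu θ P 0 + (w + nu θ P 1))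
  rw [show P.s0 - θ.tht - θ.th0 = P.s0 - (θ.th0 + θ.tht) by ring,
    show P.s0 - θ.th1 - θ.thinf = P.s0 - (θ.th1 + θ.thinf) by ring]
  refine mul_left_cancel₀
    (mul_ne_zero (mul_ne_zero (mul_ne_zero (by norm_num : (4 : ℂ) ≠ 0) hY) hH) hp) ?_
  linear_combination -key

/-- The quotient of sines produced by the shift `σ₁ₜ ↦ σ₁ₜ + 1` equals `s₁ₜ`. -/
lemma sinpi_ratio_shift1 (h : IsGeneric θ P) (hP : P ∈ monodromySpace θ) {w : ℂ}
    (hw : e2pi w = zPlus θ P) :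
    sinpi (w + lam θ P 1) * sinpi (w + lam θ P 2) *
        (sinpi (P.s1 + θ.th1 + θ.tht) * sinpi (P.s1 + θ.thinf + θ.th0)) =
      s1t θ P * (sinpi (P.s1 + θ.th1 - θ.tht) * sinpi (P.s1 + θ.thinf - θ.th0)) *
        (sinpi (w + nu θ P 2) * sinpi (w + nu θ P 3)) := by
  have hD : jimboDen1 θ 1 P ≠ 0 := h.jimboDen1_ne_zero (by simp [signs])
  have hz := zPlus_quadratic hP h.den
  have hq := q01_eq h.den
  -- The quadratic is invariant under σ₀ₜ ↔ σ₁ₜ, θ₀ ↔ θ₁, so `shift_identity` applies with these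
  -- roles exchanged.
  have hA : pointQuadA θ P = quadA (e2pi P.s1) (e2pi P.s0) (e2pi θ.th1) (e2pi θ.tht)
      (e2pi θ.th0) (e2pi θ.thinf) := by
    rw [pointQuadA, quadA, quadA]; ring
  have hB : pointQuadB θ P = quadB (e2pi P.s1) (e2pi P.s0) (e2pi θ.th1) (e2pi θ.tht)
      (e2pi θ.th0) (e2pi θ.thinf) := by
    rw [pointQuadB, quadB, quadB]; ring
  have hC : pointQuadC θ P = quadC (e2pi P.s1) (e2pi P.s0) (e2pi θ.th1) (e2pi θ.tht)
      (e2pi θ.th0) (e2pi θ.thinf) := by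
    rw [pointQuadC, quadC, quadC, quadA, quadA]; ring
  rw [hA, hB] at hz hq
  rw [hC] at hz
  have key := shift_identity (e2pi_ne_zero P.s1) (e2pi_ne_zero P.s0)
    (e2pi_ne_zero θ.th1) (e2pi_ne_zero θ.tht) (e2pi_ne_zero θ.th0) (e2pi_ne_zero θ.thinf)
    hz hq (q' := q0t θ P) (by
      simp only [← tr_eq]
      rw [q0t, q01, omega0t, omega01]
      ring)
  rw [← hw] at key
  simp only [← e2pi_add, ← tr_eq] at key
  rw [← four_mul_sinpi_add_mul_sinpi_sub, ← four_mul_sinpi_add_mul_sinpi_sub] at key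
  have s1 := sinpi_mul_sinpi (w + lam θ P 1) (w + lam θ P 2)
  have s2 := sinpi_mul_sinpi (w + nu θ P 3) (w + nu θ P 2)
  have hh : halfExp (w + lam θ P 1 + (w + lam θ P 2)) =
      halfExp (w + nu θ P 3 + (w + nu θ P 2)) * e2pi P.s0 := by
    rw [← halfExp_sq, sq, ← halfExp_add, ← halfExp_add]
    congr 1
    simp only [nu, lam, Matrix.cons_val]
    ring
  have hJ : s1t θ P * jimboDen1 θ 1 P = q01 θ P * (e2pi P.s1)⁻¹ - q0t θ P := by
    rw [s1t, jimbo1, ← jimboDen1, div_mul_cancel₀ _ hD, neg_one_mul, e2pi_neg]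
  have hDe : jimboDen1 θ 1 P = 16 *
      (sinpi (P.s1 - (θ.th1 + θ.tht)) * sinpi (P.s1 - (θ.th0 + θ.thinf))) *
      (sinpi (P.s1 + θ.th1 - θ.tht) * sinpi (P.s1 + θ.thinf - θ.th0)) := by
    rw [jimboDen1, prod_signs,
      show θ.tht - 1 * P.s1 + 1 * θ.th1 = -(P.s1 - (θ.th1 + θ.tht)) by ring,
      show θ.th0 - 1 * P.s1 + 1 * θ.thinf = -(P.s1 - (θ.th0 + θ.thinf)) by ring,
      show θ.tht - 1 * P.s1 + -1 * θ.th1 = -(P.s1 + θ.th1 - θ.tht) by ring,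
      show θ.th0 - 1 * P.s1 + -1 * θ.thinf = -(P.s1 + θ.thinf - θ.th0) by ring]
    simp only [sinpi_neg]
    ring
  rw [hDe] at hD hJ
  have hp := left_ne_zero_of_mul hD
  rw [hh] at s1
  rw [show w + (P.s1 + P.s0 + θ.th1 + θ.th0) = w + lam θ P 1 by simp [lam]; ring,
    show w + (P.s1 + P.s0 + θ.tht + θ.thinf) = w + lam θ P 2 by simp [lam]; ring, ← s1,
    show w + (P.s1 + θ.th1 + θ.tht) = w + nu θ P 3 by simp [nu]; ring,
    show w + (P.s1 + θ.th0 + θ.thinf) = w + nu θ P 2 by simp [nu], ← s2, ← hJ] at key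
  have hY := e2pi_ne_zero P.s0
  have hH := halfExp_ne_zero (w + nu θ P 3 + (w + nu θ P 2))
  rw [show P.s1 + θ.th1 + θ.tht = P.s1 + (θ.th1 + θ.tht) by ring,
    show P.s1 + θ.thinf + θ.th0 = P.s1 + (θ.th0 + θ.thinf) by ring]
  refine mul_left_cancel₀
    (mul_ne_zero (mul_ne_zero (mul_ne_zero (by norm_num : (4 : ℂ) ≠ 0) hY) hH) hp) ?_
  linear_combination -key

end IsGeneric

/-! ### Reduction of the structure constants to Ĝ. -/

/-- The product of `G(1 + t ± c ± s)` over all signs. -/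
def barnesProd (t c s : ℂ) : ℂ :=
  barnesG (1 + (t + c + s)) * barnesG (1 + (t + c - s)) *
    (barnesG (1 + (t - c + s)) * barnesG (1 + (t - c - s)))

/-- The product of `G(1 ± s ± t ± c)` over the triples of signs with product `+`. -/
def twistedBarnesProd (t c s : ℂ) : ℂ :=
  barnesG (1 + (t + c + s)) * barnesG (1 + (s - t - c)) *
    (barnesG (1 - (s - t + c)) * barnesG (1 - (s + t - c)))

lemma structC_eq (a t b c σ : ℂ) :
    structC a t b c σ = barnesProd t c σ * barnesProd a b σ /
      (barnesG (1 + 2 * σ) * barnesG (1 + -(2 * σ))) := by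
  simp only [structC, prod_signs, barnesProd]
  congr 1
  · ring_nf
  · ring_nf

lemma explicitProduct_eq (θ : Params) (P : Point) (w : ℂ) :
    explicitProduct θ P w =
      (twistedBarnesProd θ.tht (-θ.th1) P.s1 * twistedBarnesProd θ.th0 (-θ.thinf) P.s1) /
        (twistedBarnesProd θ.tht θ.th0 P.s0 * twistedBarnesProd θ.th1 θ.thinf P.s0) *
      ((barnesG (1 + 2 * P.s0) * barnesG (1 + -(2 * P.s0))) /
        (barnesG (1 + 2 * P.s1) * barnesG (1 + -(2 * P.s1)))) *
      ∏ k, barnesGHat (w + nu θ P k) / barnesGHat (w + lam θ P k) := by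
  rw [explicitProduct]
  simp only [Finset.prod_div_distrib]
  congr 1
  simp only [prod_signs, twistedBarnesProd]
  congr 1
  · congr 1 <;> ring_nf
  · congr 1 <;> ring_nf

lemma barnesProd_ne_zero {t c s : ℂ}
    (h : ∀ ε ∈ signs, ∀ ε' ∈ signs, sinpi (t + ε * c + ε' * s) ≠ 0) : barnesProd t c s ≠ 0 := by
  have h1 := h 1 one_mem_signs 1 one_mem_signs
  have h2 := h 1 one_mem_signs (-1) neg_one_mem_signs
  have h3 := h (-1) neg_one_mem_signs 1 one_mem_signs
  have h4 := h (-1) neg_one_mem_signs (-1) neg_one_mem_signs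
  simp only [one_mul, neg_mul, ← sub_eq_add_neg] at h1 h2 h3 h4
  exact mul_ne_zero (mul_ne_zero (barnesG_ne_zero h1) (barnesG_ne_zero h2))
    (mul_ne_zero (barnesG_ne_zero h3) (barnesG_ne_zero h4))

lemma sinpi_neg_ne_zero {u : ℂ} (h : sinpi u ≠ 0) : sinpi (-u) ≠ 0 := by
  rw [sinpi_neg]
  exact neg_ne_zero.mpr h

lemma barnesG_one_sub_ne_zero {u : ℂ} (h : sinpi u ≠ 0) : barnesG (1 - u) ≠ 0 := by
  rw [sub_eq_add_neg]
  exact barnesG_ne_zero (sinpi_neg_ne_zero h)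

section
variable {t c s : ℂ} (h : ∀ ε ∈ signs, ∀ ε' ∈ signs, sinpi (t + ε * c + ε' * s) ≠ 0)
include h

lemma sinpi_ne_zero_of_signs :
    sinpi (s + t - c) ≠ 0 ∧ sinpi (s - t - c) ≠ 0 ∧ sinpi (s + c - t) ≠ 0 ∧
      sinpi (s + c + t) ≠ 0 := by
  have h1 := h 1 one_mem_signs 1 one_mem_signs
  have h2 := h 1 one_mem_signs (-1) neg_one_mem_signs
  have h3 := h (-1) neg_one_mem_signs 1 one_mem_signs
  have h4 := h (-1) neg_one_mem_signs (-1) neg_one_mem_signs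
  refine ⟨?_, ?_, ?_, ?_⟩
  · convert h3 using 2; ring
  · convert sinpi_neg_ne_zero h2 using 2; ring
  · convert sinpi_neg_ne_zero h4 using 2; ring
  · convert h1 using 2; ring

lemma twistedBarnesProd_ne_zero : twistedBarnesProd t c s ≠ 0 := by
  obtain ⟨h1, h2, h3, h4⟩ := sinpi_ne_zero_of_signs h
  refine mul_ne_zero (mul_ne_zero (barnesG_ne_zero ?_) (barnesG_ne_zero h2))
    (mul_ne_zero (barnesG_one_sub_ne_zero ?_) (barnesG_one_sub_ne_zero h1))
  · convert h4 using 2; ring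
  · convert h3 using 2; ring

/-- Two of the four Barnes factors are common; the other two arguments are reflected and assemble
into values of Ĝ. -/
lemma barnesProd_div_twistedBarnesProd :
    barnesProd t c s / twistedBarnesProd t c s =
      barnesGHat (s + t - c) / barnesGHat (s - t - c) := by
  obtain ⟨h1, h2, h3, h4⟩ := sinpi_ne_zero_of_signs h
  have e1 : t + c + s = s + c + t := by ring
  have e2 : 1 + (t + c - s) = 1 - (s - t - c) := by ring
  have e3 : t - c + s = s + t - c := by ring
  have e4 : 1 + (t - c - s) = 1 - (s + c - t) := by ring
  have e5 : s - t + c = s + c - t := by ring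
  rw [barnesProd, twistedBarnesProd, barnesGHat, barnesGHat, e1, e2, e3, e4, e5]
  have := barnesG_ne_zero h1
  have := barnesG_ne_zero h2
  have := barnesG_ne_zero h4
  have := barnesG_one_sub_ne_zero h1
  have := barnesG_one_sub_ne_zero h2
  have := barnesG_one_sub_ne_zero h3
  field_simp

lemma twistedBarnesProd_neg_div_barnesProd :
    twistedBarnesProd t (-c) s / barnesProd t c s =
      barnesGHat (s + c - t) / barnesGHat (s + c + t) := by
  obtain ⟨h1, h2, h3, h4⟩ := sinpi_ne_zero_of_signs h
  have e1 : t + c + s = s + c + t := by ring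
  have e2 : 1 + (t + c - s) = 1 - (s - t - c) := by ring
  have e3 : t - c + s = s + t - c := by ring
  have e4 : 1 + (t - c - s) = 1 - (s + c - t) := by ring
  have e5 : t + -c + s = s + t - c := by ring
  have e6 : s - t - -c = s + c - t := by ring
  have e7 : s - t + -c = s - t - c := by ring
  have e8 : s + t - -c = s + c + t := by ring
  rw [barnesProd, twistedBarnesProd, barnesGHat, barnesGHat, e1, e2, e3, e4, e5, e6, e7, e8]
  have := barnesG_ne_zero h1
  have := barnesG_ne_zero h3
  have := barnesG_ne_zero h4
  have := barnesG_one_sub_ne_zero h2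
  have := barnesG_one_sub_ne_zero h3
  have := barnesG_one_sub_ne_zero h4
  field_simp

end

/-- The factor of the particular solution which does not involve `ω₊`. -/
def baseFactor (θ : Params) (P : Point) : ℂ :=
  barnesGHat (P.s0 + θ.tht - θ.th0) / barnesGHat (P.s0 - θ.tht - θ.th0) *
    (barnesGHat (P.s0 + θ.th1 - θ.thinf) / barnesGHat (P.s0 - θ.th1 - θ.thinf)) *
    (barnesGHat (P.s1 + θ.th1 - θ.tht) / barnesGHat (P.s1 + θ.th1 + θ.tht) *
      (barnesGHat (P.s1 + θ.thinf - θ.th0) / barnesGHat (P.s1 + θ.thinf + θ.th0)))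

/-- The factor of the particular solution which involves `ω₊`. -/
def tetraFactor (θ : Params) (P : Point) (w : ℂ) : ℂ :=
  ∏ k, barnesGHat (w + nu θ P k) / barnesGHat (w + lam θ P k)

namespace IsGeneric

variable {θ : Params} {P : Point}

lemma structC_ne_zero_s0 (h : IsGeneric θ P) :
    structC θ.th1 θ.tht θ.thinf θ.th0 P.s0 ≠ 0 := by
  rw [structC_eq]
  exact div_ne_zero (mul_ne_zero (barnesProd_ne_zero h.sin_0t) (barnesProd_ne_zero h.sin_1inf))
    (mul_ne_zero (barnesG_ne_zero h.sin_s0) (barnesG_ne_zero (sinpi_neg_ne_zero h.sin_s0)))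

lemma structC_ne_zero_s1 (h : IsGeneric θ P) :
    structC θ.th0 θ.tht θ.thinf θ.th1 P.s1 ≠ 0 := by
  rw [structC_eq]
  exact div_ne_zero (mul_ne_zero (barnesProd_ne_zero h.sin_t1) (barnesProd_ne_zero h.sin_0inf))
    (mul_ne_zero (barnesG_ne_zero h.sin_s1) (barnesG_ne_zero (sinpi_neg_ne_zero h.sin_s1)))

lemma explicitProduct_mul_structC_div (h : IsGeneric θ P) (w : ℂ) :
    explicitProduct θ P w * structC θ.th1 θ.tht θ.thinf θ.th0 P.s0 /
      structC θ.th0 θ.tht θ.thinf θ.th1 P.s1 = baseFactor θ P * tetraFactor θ P w := by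
  rw [explicitProduct_eq, structC_eq, structC_eq, baseFactor, tetraFactor,
    ← barnesProd_div_twistedBarnesProd h.sin_0t, ← barnesProd_div_twistedBarnesProd h.sin_1inf,
    ← twistedBarnesProd_neg_div_barnesProd h.sin_t1,
    ← twistedBarnesProd_neg_div_barnesProd h.sin_0inf]
  have := barnesProd_ne_zero h.sin_t1
  have := barnesProd_ne_zero h.sin_0inf
  have := twistedBarnesProd_ne_zero h.sin_0t
  have := twistedBarnesProd_ne_zero h.sin_1inf
  have := barnesG_ne_zero h.sin_s0
  have := barnesG_ne_zero h.sin_s1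
  have := barnesG_ne_zero (sinpi_neg_ne_zero h.sin_s0)
  have := barnesG_ne_zero (sinpi_neg_ne_zero h.sin_s1)
  generalize (∏ k, barnesGHat (w + nu θ P k) / barnesGHat (w + lam θ P k)) = H
  field_simp

lemma chiBar_eq_iff (h : IsGeneric θ P) (χ : Point → ℂ) (r w : ℂ) :
    chiBar θ χ P = r * explicitProduct θ P w ↔
      χ P = r * (baseFactor θ P * tetraFactor θ P w) := by
  have h0 := h.structC_ne_zero_s0
  have h1 := h.structC_ne_zero_s1
  rw [← h.explicitProduct_mul_structC_div, chiBar, div_eq_iff h0, ← mul_div_assoc,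
    eq_div_iff h1, mul_assoc]

/-! ### Dependence on ω₊ and behaviour under shifts. -/

lemma sinpi_nu_sub_lam (h : IsGeneric θ P) (j k : Fin 4) : sinpi (nu θ P j - lam θ P k) ≠ 0 := by
  have p := one_mem_signs
  have m := neg_one_mem_signs
  -- The sixteen differences are, up to sign, the sixteen arguments excluded from ℤ by genericity,
  -- each occurring once.
  fin_cases j <;> fin_cases k <;> simp only [nu, lam, Fin.zero_eta, Fin.mk_one, Fin.reduceFinMk,
    Matrix.cons_val]
  · convert sinpi_neg_ne_zero (h.sin_1inf 1 p (-1) m) using 2; ring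
  · convert h.sin_t1 (-1) m (-1) m using 2; ring
  · convert h.sin_0inf (-1) m (-1) m using 2; ring
  · convert h.sin_0t 1 p 1 p using 2; ring
  · convert sinpi_neg_ne_zero (h.sin_0t 1 p (-1) m) using 2; ring
  · convert sinpi_neg_ne_zero (h.sin_0inf (-1) m 1 p) using 2; ring
  · convert sinpi_neg_ne_zero (h.sin_t1 (-1) m 1 p) using 2; ring
  · convert h.sin_1inf 1 p 1 p using 2; ring
  · convert sinpi_neg_ne_zero (h.sin_t1 1 p (-1) m) using 2; ring
  · convert sinpi_neg_ne_zero (h.sin_1inf (-1) m 1 p) using 2; ring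
  · convert sinpi_neg_ne_zero (h.sin_0t (-1) m 1 p) using 2; ring
  · convert h.sin_0inf 1 p 1 p using 2; ring
  · convert sinpi_neg_ne_zero (h.sin_0inf 1 p (-1) m) using 2; ring
  · convert h.sin_0t (-1) m (-1) m using 2; ring
  · convert h.sin_1inf (-1) m (-1) m using 2; ring
  · convert h.sin_t1 1 p 1 p using 2; ring

section
variable (h : IsGeneric θ P) (hP : P ∈ monodromySpace θ) {w : ℂ} (hw : e2pi w = zPlus θ P)
include h hP hw

lemma tetraEq_e2pi :
    ∏ k, (1 - e2pi (w + nu θ P k)) = ∏ k, (1 - e2pi (w + lam θ P k)) := by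
  have := tetraEq_zPlus hP h.den
  rw [TetraEq, ← hw] at this
  simpa only [e2pi_add] using this

omit hP hw in
lemma not_both_eq_one (j k : Fin 4) (hj : e2pi (w + nu θ P j) = 1)
    (hk : e2pi (w + lam θ P k) = 1) : False := by
  refine e2pi_ne_one (h.sinpi_nu_sub_lam j k) ?_
  rw [show nu θ P j - lam θ P k = (w + nu θ P j) - (w + lam θ P k) by ring, e2pi_sub, hj, hk]
  simp

/-- A vanishing factor on one side of the quartic equation forces one on the other, and then some
ν_j - λ_k would be an integer. -/
lemma sinpi_nu_ne_zero (j : Fin 4) : sinpi (w + nu θ P j) ≠ 0 := by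
  refine sinpi_ne_zero fun hj => ?_
  have ht := h.tetraEq_e2pi hP hw
  rw [Finset.prod_eq_zero (Finset.mem_univ j) (by rw [hj, sub_self]), eq_comm,
    Finset.prod_eq_zero_iff] at ht
  obtain ⟨k, -, hk⟩ := ht
  exact h.not_both_eq_one j k hj (sub_eq_zero.mp hk).symm

lemma sinpi_lam_ne_zero (k : Fin 4) : sinpi (w + lam θ P k) ≠ 0 := by
  refine sinpi_ne_zero fun hk => ?_
  have ht := h.tetraEq_e2pi hP hw
  rw [eq_comm, Finset.prod_eq_zero (Finset.mem_univ k) (by rw [hk, sub_self]), eq_comm,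
    Finset.prod_eq_zero_iff] at ht
  obtain ⟨j, -, hj⟩ := ht
  exact h.not_both_eq_one j k (sub_eq_zero.mp hj).symm hk

/-- Since Σν_k = Σλ_k, the exponential prefactors on the two sides of the quartic equation coincide
and cancel. -/
lemma prod_sinpi_nu_eq :
    ∏ k, sinpi (w + nu θ P k) = ∏ k, sinpi (w + lam θ P k) := by
  have ht := h.tetraEq_e2pi hP hw
  rw [Fin.prod_univ_four, Fin.prod_univ_four] at ht ⊢
  have a1 := sinpi_mul_sinpi (w + nu θ P 0) (w + nu θ P 1)
  have a2 := sinpi_mul_sinpi (w + nu θ P 2) (w + nu θ P 3)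
  have b1 := sinpi_mul_sinpi (w + lam θ P 0) (w + lam θ P 1)
  have b2 := sinpi_mul_sinpi (w + lam θ P 2) (w + lam θ P 3)
  have hh : halfExp (w + nu θ P 0 + (w + nu θ P 1)) * halfExp (w + nu θ P 2 + (w + nu θ P 3)) =
      halfExp (w + lam θ P 0 + (w + lam θ P 1)) * halfExp (w + lam θ P 2 + (w + lam θ P 3)) := by
    rw [← halfExp_add, ← halfExp_add]
    congr 1
    simp only [nu, lam, Matrix.cons_val]
    ring
  rw [mul_assoc (_ * _), mul_assoc (_ * _), ← a1, ← a2, ← b1, ← b2] at ht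
  have h1 := halfExp_ne_zero (w + nu θ P 0 + (w + nu θ P 1))
  have h2 := halfExp_ne_zero (w + nu θ P 2 + (w + nu θ P 3))
  have h3 : (16 : ℂ) * (halfExp (w + nu θ P 0 + (w + nu θ P 1)) *
    halfExp (w + nu θ P 2 + (w + nu θ P 3))) ≠ 0 := by simp [h1, h2]
  refine mul_left_cancel₀ h3 ?_
  linear_combination ht - 16 * (sinpi (w + lam θ P 0) * sinpi (w + lam θ P 1) *
    sinpi (w + lam θ P 2) * sinpi (w + lam θ P 3)) * hh

lemma tetraFactor_ne_zero : tetraFactor θ P w ≠ 0 :=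
  Finset.prod_ne_zero_iff.mpr fun k _ => div_ne_zero
    (barnesGHat_ne_zero (h.sinpi_nu_ne_zero hP hw k))
    (barnesGHat_ne_zero (h.sinpi_lam_ne_zero hP hw k))

lemma tetraFactor_add_one : tetraFactor θ P (w + 1) = tetraFactor θ P w := by
  have hpi : (Real.pi : ℂ) ≠ 0 := by exact_mod_cast Real.pi_ne_zero
  have e : ∀ k, barnesGHat (w + 1 + nu θ P k) / barnesGHat (w + 1 + lam θ P k) =
      sinpi (w + lam θ P k) / sinpi (w + nu θ P k) *
        (barnesGHat (w + nu θ P k) / barnesGHat (w + lam θ P k)) := by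
    intro k
    have h1 := h.sinpi_nu_ne_zero hP hw k
    have h2 := h.sinpi_lam_ne_zero hP hw k
    have h3 := barnesGHat_ne_zero h2
    rw [add_right_comm w 1, add_right_comm w 1, barnesGHat_add_one h1, barnesGHat_add_one h2]
    field_simp
  have hn : ∏ k, sinpi (w + lam θ P k) ≠ 0 :=
    Finset.prod_ne_zero_iff.mpr fun k _ => h.sinpi_lam_ne_zero hP hw k
  rw [tetraFactor, Finset.prod_congr rfl fun k _ => e k, Finset.prod_mul_distrib,
    Finset.prod_div_distrib, h.prod_sinpi_nu_eq hP hw, div_self hn, one_mul, tetraFactor]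

/-- Makes the choice of the logarithm ω₊ immaterial: two choices differ by an integer. -/
lemma tetraFactor_eq_of_e2pi_eq {w' : ℂ} (hw' : e2pi w' = zPlus θ P) :
    tetraFactor θ P w' = tetraFactor θ P w := by
  have key : ∀ n : ℤ, tetraFactor θ P (w + n) = tetraFactor θ P w := by
    have hn : ∀ n : ℤ, e2pi (w + n) = zPlus θ P := fun n => by
      rw [e2pi_add, e2pi_eq_one_iff (u := (n : ℂ)) |>.mpr ⟨n, rfl⟩, mul_one, hw]
    intro n
    induction n using Int.induction_on with
    | zero => simp
    | succ i ih =>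
      rw [← ih, ← h.tetraFactor_add_one hP (hn i)]
      push_cast
      ring_nf
    | pred i ih =>
      rw [← ih, ← h.tetraFactor_add_one hP (hn (-i - 1))]
      push_cast
      ring_nf
  have h1 : e2pi (w' - w) = 1 := by
    rw [e2pi_sub, hw', hw, mul_inv_cancel₀]
    rw [← hw]
    exact e2pi_ne_zero w
  obtain ⟨n, hn⟩ := e2pi_eq_one_iff.mp h1
  rw [← key n, ← hn, add_sub_cancel]

omit hP hw in
lemma baseFactor_ne_zero : baseFactor θ P ≠ 0 := by
  obtain ⟨a1, a2, -, -⟩ := sinpi_ne_zero_of_signs h.sin_0t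
  obtain ⟨b1, b2, -, -⟩ := sinpi_ne_zero_of_signs h.sin_1inf
  obtain ⟨-, -, c3, c4⟩ := sinpi_ne_zero_of_signs h.sin_t1
  obtain ⟨-, -, d3, d4⟩ := sinpi_ne_zero_of_signs h.sin_0inf
  have := @barnesGHat_ne_zero
  simp [baseFactor, *]

omit hP hw in
lemma baseFactor_shift0 : baseFactor θ (shift0 P) =
    (sinpi (P.s0 - θ.tht - θ.th0) * sinpi (P.s0 - θ.th1 - θ.thinf)) /
      (sinpi (P.s0 + θ.tht - θ.th0) * sinpi (P.s0 + θ.th1 - θ.thinf)) * baseFactor θ P := by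
  obtain ⟨a1, a2, -, -⟩ := sinpi_ne_zero_of_signs h.sin_0t
  obtain ⟨b1, b2, -, -⟩ := sinpi_ne_zero_of_signs h.sin_1inf
  have hpi : (Real.pi : ℂ) ≠ 0 := by exact_mod_cast Real.pi_ne_zero
  have := barnesGHat_ne_zero a2
  have := barnesGHat_ne_zero b2
  rw [baseFactor, baseFactor, shift0]
  simp only
  rw [show P.s0 + 1 + θ.tht - θ.th0 = P.s0 + θ.tht - θ.th0 + 1 by ring,
    show P.s0 + 1 - θ.tht - θ.th0 = P.s0 - θ.tht - θ.th0 + 1 by ring,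
    show P.s0 + 1 + θ.th1 - θ.thinf = P.s0 + θ.th1 - θ.thinf + 1 by ring,
    show P.s0 + 1 - θ.th1 - θ.thinf = P.s0 - θ.th1 - θ.thinf + 1 by ring,
    barnesGHat_add_one a1, barnesGHat_add_one a2, barnesGHat_add_one b1, barnesGHat_add_one b2]
  generalize (barnesGHat (P.s1 + θ.th1 - θ.tht) / barnesGHat (P.s1 + θ.th1 + θ.tht) *
      (barnesGHat (P.s1 + θ.thinf - θ.th0) / barnesGHat (P.s1 + θ.thinf + θ.th0))) = r
  field_simp

omit hP hw in
lemma baseFactor_shift1 : baseFactor θ (shift1 P) =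
    (sinpi (P.s1 + θ.th1 + θ.tht) * sinpi (P.s1 + θ.thinf + θ.th0)) /
      (sinpi (P.s1 + θ.th1 - θ.tht) * sinpi (P.s1 + θ.thinf - θ.th0)) * baseFactor θ P := by
  obtain ⟨-, -, a1, a2⟩ := sinpi_ne_zero_of_signs h.sin_t1
  obtain ⟨-, -, b1, b2⟩ := sinpi_ne_zero_of_signs h.sin_0inf
  have hpi : (Real.pi : ℂ) ≠ 0 := by exact_mod_cast Real.pi_ne_zero
  have := barnesGHat_ne_zero a2
  have := barnesGHat_ne_zero b2
  rw [baseFactor, baseFactor, shift1]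
  simp only
  rw [show P.s1 + 1 + θ.th1 - θ.tht = P.s1 + θ.th1 - θ.tht + 1 by ring,
    show P.s1 + 1 + θ.th1 + θ.tht = P.s1 + θ.th1 + θ.tht + 1 by ring,
    show P.s1 + 1 + θ.thinf - θ.th0 = P.s1 + θ.thinf - θ.th0 + 1 by ring,
    show P.s1 + 1 + θ.thinf + θ.th0 = P.s1 + θ.thinf + θ.th0 + 1 by ring,
    barnesGHat_add_one a1, barnesGHat_add_one a2, barnesGHat_add_one b1, barnesGHat_add_one b2]
  generalize barnesGHat (P.s0 + θ.tht - θ.th0) / barnesGHat (P.s0 - θ.tht - θ.th0) *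
    (barnesGHat (P.s0 + θ.th1 - θ.thinf) / barnesGHat (P.s0 - θ.th1 - θ.thinf)) = r
  field_simp

lemma tetraFactor_shift0 : tetraFactor θ (shift0 P) w =
    (sinpi (w + lam θ P 1) * sinpi (w + lam θ P 2)) /
      (sinpi (w + nu θ P 0) * sinpi (w + nu θ P 1)) * tetraFactor θ P w := by
  have hpi : (Real.pi : ℂ) ≠ 0 := by exact_mod_cast Real.pi_ne_zero
  have n0 := h.sinpi_nu_ne_zero hP hw 0
  have n1 := h.sinpi_nu_ne_zero hP hw 1
  have l1 := h.sinpi_lam_ne_zero hP hw 1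
  have l2 := h.sinpi_lam_ne_zero hP hw 2
  have := barnesGHat_ne_zero l1
  have := barnesGHat_ne_zero l2
  have := barnesGHat_ne_zero (h.sinpi_lam_ne_zero hP hw 0)
  have := barnesGHat_ne_zero (h.sinpi_lam_ne_zero hP hw 3)
  rw [tetraFactor, tetraFactor, Fin.prod_univ_four, Fin.prod_univ_four,
    show w + nu θ (shift0 P) 0 = w + nu θ P 0 + 1 by simp [nu, shift0]; ring,
    show w + nu θ (shift0 P) 1 = w + nu θ P 1 + 1 by simp [nu, shift0]; ring,
    show w + nu θ (shift0 P) 2 = w + nu θ P 2 by simp [nu, shift0],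
    show w + nu θ (shift0 P) 3 = w + nu θ P 3 by simp [nu, shift0],
    show w + lam θ (shift0 P) 0 = w + lam θ P 0 by simp [lam],
    show w + lam θ (shift0 P) 1 = w + lam θ P 1 + 1 by simp [lam, shift0]; ring,
    show w + lam θ (shift0 P) 2 = w + lam θ P 2 + 1 by simp [lam, shift0]; ring,
    show w + lam θ (shift0 P) 3 = w + lam θ P 3 by simp [lam],
    barnesGHat_add_one n0, barnesGHat_add_one n1, barnesGHat_add_one l1, barnesGHat_add_one l2]
  field_simp

lemma tetraFactor_shift1 : tetraFactor θ (shift1 P) w =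
    (sinpi (w + lam θ P 1) * sinpi (w + lam θ P 2)) /
      (sinpi (w + nu θ P 2) * sinpi (w + nu θ P 3)) * tetraFactor θ P w := by
  have hpi : (Real.pi : ℂ) ≠ 0 := by exact_mod_cast Real.pi_ne_zero
  have n2 := h.sinpi_nu_ne_zero hP hw 2
  have n3 := h.sinpi_nu_ne_zero hP hw 3
  have l1 := h.sinpi_lam_ne_zero hP hw 1
  have l2 := h.sinpi_lam_ne_zero hP hw 2
  have := barnesGHat_ne_zero l1
  have := barnesGHat_ne_zero l2
  have := barnesGHat_ne_zero (h.sinpi_lam_ne_zero hP hw 0)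
  have := barnesGHat_ne_zero (h.sinpi_lam_ne_zero hP hw 3)
  rw [tetraFactor, tetraFactor, Fin.prod_univ_four, Fin.prod_univ_four,
    show w + nu θ (shift1 P) 0 = w + nu θ P 0 by simp [nu, shift1],
    show w + nu θ (shift1 P) 1 = w + nu θ P 1 by simp [nu, shift1],
    show w + nu θ (shift1 P) 2 = w + nu θ P 2 + 1 by simp [nu, shift1]; ring,
    show w + nu θ (shift1 P) 3 = w + nu θ P 3 + 1 by simp [nu, shift1]; ring,
    show w + lam θ (shift1 P) 0 = w + lam θ P 0 by simp [lam],
    show w + lam θ (shift1 P) 1 = w + lam θ P 1 + 1 by simp [lam, shift1]; ring,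
    show w + lam θ (shift1 P) 2 = w + lam θ P 2 + 1 by simp [lam, shift1]; ring,
    show w + lam θ (shift1 P) 3 = w + lam θ P 3 by simp [lam],
    barnesGHat_add_one n2, barnesGHat_add_one n3, barnesGHat_add_one l1, barnesGHat_add_one l2]
  field_simp

end

end IsGeneric

/-! ### The particular and the general solution. -/

lemma zPlus_shift0 (θ : Params) (P : Point) : zPlus θ (shift0 P) = zPlus θ P := by
  simp only [zPlus, zNum_eq, zDen_eq, pointQuadA, pointQuadB, q01, shift0, tr_eq, e2pi_add_one]

lemma zPlus_shift1 (θ : Params) (P : Point) : zPlus θ (shift1 P) = zPlus θ P := by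
  simp only [zPlus, zNum_eq, zDen_eq, pointQuadA, pointQuadB, q01, shift1, tr_eq, e2pi_add_one]

/-- The particular solution of the two difference equations. -/
def baseSolution (θ : Params) (ω : Point → ℂ) (P : Point) : ℂ :=
  baseFactor θ P * tetraFactor θ P (ω P)

section
variable {θ : Params} {D : Set Point} {ω : Point → ℂ}

lemma baseSolution_shift0 (hD : D ⊆ monodromySpace θ) (hgen : ∀ P ∈ D, IsGeneric θ P)
    (hω : ∀ P ∈ D, e2pi (ω P) = zPlus θ P) {P : Point} (hP : P ∈ D) (hP' : shift0 P ∈ D) :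
    baseSolution θ ω (shift0 P) = (s0t θ P)⁻¹ * baseSolution θ ω P := by
  have h := hgen P hP
  have hM := hD hP
  have hw := hω P hP
  have hr := h.sinpi_ratio_shift0 hM hw
  have n0 := h.sinpi_nu_ne_zero hM hw 0
  have n1 := h.sinpi_nu_ne_zero hM hw 1
  obtain ⟨a1, -, -, -⟩ := sinpi_ne_zero_of_signs h.sin_0t
  obtain ⟨b1, -, -, -⟩ := sinpi_ne_zero_of_signs h.sin_1inf
  rw [← eq_inv_of_mul_eq_one_left (h.jimbo0_mul hM), baseSolution,
    -- The value of ω at the shifted point is unrelated to `ω P` except through z₊; replacing it by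
    -- `ω P` leaves only the shifts of ν and λ.
    (hgen _ hP').tetraFactor_eq_of_e2pi_eq (hD hP') (w := ω P) (by rw [hw, zPlus_shift0])
      (hω _ hP'), h.baseFactor_shift0, h.tetraFactor_shift0 hM hw, baseSolution]
  field_simp
  linear_combination (baseFactor θ P * tetraFactor θ P (ω P)) * hr

lemma baseSolution_shift1 (hD : D ⊆ monodromySpace θ) (hgen : ∀ P ∈ D, IsGeneric θ P)
    (hω : ∀ P ∈ D, e2pi (ω P) = zPlus θ P) {P : Point} (hP : P ∈ D) (hP' : shift1 P ∈ D) :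
    baseSolution θ ω (shift1 P) = s1t θ P * baseSolution θ ω P := by
  have h := hgen P hP
  have hM := hD hP
  have hw := hω P hP
  have hr := h.sinpi_ratio_shift1 hM hw
  have n0 := h.sinpi_nu_ne_zero hM hw 2
  have n1 := h.sinpi_nu_ne_zero hM hw 3
  obtain ⟨-, -, a1, -⟩ := sinpi_ne_zero_of_signs h.sin_t1
  obtain ⟨-, -, b1, -⟩ := sinpi_ne_zero_of_signs h.sin_0inf
  rw [baseSolution,
    (hgen _ hP').tetraFactor_eq_of_e2pi_eq (hD hP') (w := ω P) (by rw [hw, zPlus_shift1])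
      (hω _ hP'), h.baseFactor_shift1, h.tetraFactor_shift1 hM hw, baseSolution]
  field_simp
  linear_combination (baseFactor θ P * tetraFactor θ P (ω P)) * hr

lemma baseSolution_ne_zero (hD : D ⊆ monodromySpace θ) (hgen : ∀ P ∈ D, IsGeneric θ P)
    (hω : ∀ P ∈ D, e2pi (ω P) = zPlus θ P) {P : Point} (hP : P ∈ D) :
    baseSolution θ ω P ≠ 0 :=
  mul_ne_zero (hgen P hP).baseFactor_ne_zero
    ((hgen P hP).tetraFactor_ne_zero (hD hP) (hω P hP))

end

end PVI

end

theorem lemma4 (θ : PVI.Params) (D : Set PVI.Point)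
    (hD : D ⊆ PVI.monodromySpace θ)
    (hgen : ∀ P ∈ D, PVI.IsGeneric θ P)
    (hshift0 : ∀ P, PVI.shift0 P ∈ D ↔ P ∈ D)
    (hshift1 : ∀ P, PVI.shift1 P ∈ D ↔ P ∈ D)
    (ω : PVI.Point → ℂ)
    (hω : ∀ P ∈ D, PVI.e2pi (ω P) = PVI.zPlus θ P) :
    -- the parameters are consistently defined
    (∀ P ∈ D, PVI.jimbo0 θ (-1) P * PVI.s0t θ P = 1 ∧
      PVI.jimbo1 θ (-1) P * PVI.s1t θ P = 1 ∧
      PVI.TetraEq θ P (PVI.zPlus θ P)) ∧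
    -- the general solution
    (∀ χ : PVI.Point → ℂ, PVI.IsSolution θ D χ ↔
      ∃ per : PVI.Point → ℂ,
        (∀ P, per (PVI.shift0 P) = per P ∧ per (PVI.shift1 P) = per P) ∧
        ∀ P ∈ D, PVI.chiBar θ χ P = per P * PVI.explicitProduct θ P (ω P)) ∧
    -- the general solution on a single-valued branch of `p₀₁`
    (Set.InjOn (fun P : PVI.Point => (P.s0, P.s1)) D →
      ∀ χ : PVI.Point → ℂ, PVI.IsSolution θ D χ ↔
        ∃ per : ℂ → ℂ → ℂ,
          (∀ x y, per (x + 1) y = per x y ∧ per x (y + 1) = per x y) ∧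
          ∀ P ∈ D, PVI.chiBar θ χ P = per P.s0 P.s1 * PVI.explicitProduct θ P (ω P)) := by
  classical
  have hbar : ∀ (χ : PVI.Point → ℂ) (r : ℂ), ∀ P ∈ D,
      PVI.chiBar θ χ P = r * PVI.explicitProduct θ P (ω P) ↔
        χ P = r * PVI.baseSolution θ ω P :=
    fun χ r P hP => (hgen P hP).chiBar_eq_iff χ r (ω P)
  have hb0 : ∀ P ∈ D, PVI.baseSolution θ ω (PVI.shift0 P) =
      (PVI.s0t θ P)⁻¹ * PVI.baseSolution θ ω P := fun P hP =>
    PVI.baseSolution_shift0 hD hgen hω hP ((hshift0 P).mpr hP)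
  have hb1 : ∀ P ∈ D, PVI.baseSolution θ ω (PVI.shift1 P) =
      PVI.s1t θ P * PVI.baseSolution θ ω P := fun P hP =>
    PVI.baseSolution_shift1 hD hgen hω hP ((hshift1 P).mpr hP)
  have hne : ∀ P ∈ D, PVI.baseSolution θ ω P ≠ 0 := fun P hP =>
    PVI.baseSolution_ne_zero hD hgen hω hP
  have hs0 : ∀ P ∈ D, PVI.s0t θ P ≠ 0 := fun P hP =>
    right_ne_zero_of_mul_eq_one ((hgen P hP).jimbo0_mul (hD hP))
  have hs1 : ∀ P ∈ D, PVI.s1t θ P ≠ 0 := fun P hP =>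
    right_ne_zero_of_mul_eq_one ((hgen P hP).jimbo1_mul (hD hP))
  have hsol : ∀ χ per : PVI.Point → ℂ,
      (∀ P, per (PVI.shift0 P) = per P ∧ per (PVI.shift1 P) = per P) →
      (∀ P ∈ D, χ P = per P * PVI.baseSolution θ ω P) → PVI.IsSolution θ D χ := by
    intro χ per hper h P hP
    rw [h P hP, h _ ((hshift0 P).mpr hP), h _ ((hshift1 P).mpr hP), hb0 P hP, hb1 P hP,
      (hper P).1, (hper P).2]
    exact ⟨by ring, by ring⟩
  have hquot : ∀ χ, PVI.IsSolution θ D χ → ∀ P ∈ D,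
      χ (PVI.shift0 P) / PVI.baseSolution θ ω (PVI.shift0 P) = χ P / PVI.baseSolution θ ω P ∧
      χ (PVI.shift1 P) / PVI.baseSolution θ ω (PVI.shift1 P) = χ P / PVI.baseSolution θ ω P := by
    intro χ h P hP
    rw [(h P hP).1, (h P hP).2, hb0 P hP, hb1 P hP]
    exact ⟨mul_div_mul_left _ _ (inv_ne_zero (hs0 P hP)), mul_div_mul_left _ _ (hs1 P hP)⟩
  refine ⟨fun P hP => ⟨(hgen P hP).jimbo0_mul (hD hP), (hgen P hP).jimbo1_mul (hD hP),
    PVI.tetraEq_zPlus (hD hP) (hgen P hP).den⟩, fun χ => ⟨fun h => ?_, ?_⟩,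
    fun hinj χ => ⟨fun h => ?_, ?_⟩⟩
  -- Extension by zero stays periodic everywhere because both `D` and its complement are invariant
  -- under the shifts.
  · refine ⟨fun P => if P ∈ D then χ P / PVI.baseSolution θ ω P else 0, fun P => ?_,
      fun P hP => ?_⟩
    · simp only [hshift0, hshift1]
      by_cases hP : P ∈ D
      · simp only [hP, if_true]
        exact hquot χ h P hP
      · simp [hP]
    · rw [hbar χ _ P hP]
      simp only [if_pos hP, div_mul_cancel₀ _ (hne P hP)]
  · rintro ⟨per, hper, h⟩
    exact hsol χ per hper fun P hP => (hbar χ _ P hP).mp (h P hP)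
  -- The chosen p₀₁ over (x, y) is the only one in `D` by injectivity; 0 is the value off the
  -- projection of `D`, which is again shift-invariant.
  · let per : ℂ → ℂ → ℂ := fun x y =>
      if hxy : ∃ p, (⟨x, y, p⟩ : PVI.Point) ∈ D then
        χ ⟨x, y, hxy.choose⟩ / PVI.baseSolution θ ω ⟨x, y, hxy.choose⟩ else 0
    have hper : ∀ P ∈ D, per P.s0 P.s1 = χ P / PVI.baseSolution θ ω P := by
      intro P hP
      have hxy : ∃ p, (⟨P.s0, P.s1, p⟩ : PVI.Point) ∈ D := ⟨P.p01, hP⟩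
      have hc : (⟨P.s0, P.s1, hxy.choose⟩ : PVI.Point) = P := hinj hxy.choose_spec hP rfl
      simp only [per, dif_pos hxy, hc]
    have hper0 : ∀ x y, (¬ ∃ p, (⟨x, y, p⟩ : PVI.Point) ∈ D) → per x y = 0 :=
      fun x y hxy => dif_neg hxy
    refine ⟨per, fun x y => ?_, fun P hP => ?_⟩
    · by_cases hxy : ∃ p, (⟨x, y, p⟩ : PVI.Point) ∈ D
      · obtain ⟨p, hp⟩ := hxy
        have h0 := hper _ ((hshift0 _).mpr hp)
        have h1 := hper _ ((hshift1 _).mpr hp)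
        rw [(hquot χ h _ hp).1, ← hper _ hp] at h0
        rw [(hquot χ h _ hp).2, ← hper _ hp] at h1
        exact ⟨h0, h1⟩
      · rw [hper0 x y hxy, hper0, hper0]
        · exact ⟨rfl, rfl⟩
        · exact fun ⟨p, hp⟩ => hxy ⟨p, (hshift1 _).mp hp⟩
        · exact fun ⟨p, hp⟩ => hxy ⟨p, (hshift0 _).mp hp⟩
    · rw [hbar χ _ P hP, hper P hP, div_mul_cancel₀ _ (hne P hP)]
  · rintro ⟨per, hper, h⟩
    exact hsol χ (fun P => per P.s0 P.s1) (fun P => hper P.s0 P.s1)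
      fun P hP => (hbar χ _ P hP).mp (h P hP)
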